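/- **Setting.** Conventions for forms: $2\,d\alpha(X,Y)=X\alpha(Y)-Y\alpha(X)-\alpha([X,Y])$ and $2(\alpha\wedge\beta)(X,Y)=\alpha(X)\beta(Y)-\alpha(Y)\beta(X)$ for one-forms $\alpha,\beta$. Let $0<q<n$, and let $\overline M$ be a complex manifold of complex dimension $2n+1$ with complex structure $J$, equipped with an *indefinite complex contact metric structure*: a smooth semi-Riemannian metric $\overline g$ of constant index $4q$ with $\overline g(JX,JY)=\overline g(X,Y)$, and an open covering $\{\mathcal O_i\}$ with the following data. On each $\mathcal O_i$ there is a holomorphic one-form $\theta_i$ with $\theta_i\wedge(d\theta_i)^n\neq0$, and on overlaps $\theta_i=f_{ij}\theta_j$ with $f_{ij}$ holomorphic and nowhere zero. On each $\mathcal O_i$ there are smooth one-forms $u=u_i$, $\sigma=\sigma_i$, a smooth vector field $U=U_i$ and a smooth $(1,1)$-tensor field $G=G_i$ such that, with $v=u\circ J$, $V=-JU$, $H=GJ$, one has $$G^2=H^2=-I+u\otimes U+v\otimes V,\quad \overline g(GX,Y)=-\overline g(X,GY),\quad \overline g(U,X)=u(X),\quad GJ=-JG,\quad GU=0,\quad u(U)=1,$$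 $$du(X,Y)=\overline g(X,GY)+(\sigma\wedge v)(X,Y),\qquad dv(X,Y)=\overline g(X,HY)-(\sigma\wedge u)(X,Y),$$ and $\theta_i$ is a nowhere vanishing complex multiple of $u-\sqrt{-1}\,v$. On overlaps, $u_j=au_i-bv_i$, $v_j=bu_i+av_i$, $G_j=aG_i-bH_i$, $H_j=bG_i+aH_i$ for functions $a,b$ with $a^2+b^2=1$. Put $$\begin{aligned}S(X,Y)={}&[G,G](X,Y)+2\overline g(X,GY)U-2\overline g(X,HY)V+2\{v(Y)HX-v(X)HY\}\\&+\sigma(GY)HX-\sigma(GX)HY+\sigma(X)GHY-\sigma(Y)GHX,\\ T(X,Y)={}&[H,H](X,Y)-2\overline g(X,GY)U+2\overline g(X,HY)V+2\{u(Y)GX-u(X)GY\}\\&+\sigma(HX)GY-\sigma(HY)GX+\sigma(X)GHY-\sigma(Y)GHX,\end{aligned}$$ where $[A,A](X,Y)=A^2[X,Y]+[AX,AY]-A[AX,Y]-A[X,AY]$. Assume that $\overline M$ is *normal*: $S(X,Y)=T(X,Y)=0$ for all $X,Y$ with $u(X)=v(X)=u(Y)=v(Y)=0$, and $S(U,X)=T(V,X)=0$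 for all $X$. Let $\overline\nabla$ be the Levi-Civita connection of $\overline g$, and write $J_1=J$, $J_2=G$, $J_3=H$. Let $M$ be an (immersed) null submanifold of $\overline M$: $\mathrm{Rad}\,TM=TM\cap TM^\perp$ is a smooth distribution on $M$ of constant rank $r>0$. Fix smooth bundles: a screen distribution $S(TM)$ with $TM=\mathrm{Rad}\,TM\perp S(TM)$, a screen transversal bundle $S(TM^\perp)$ with $TM^\perp=\mathrm{Rad}\,TM\perp S(TM^\perp)$, and a null bundle $l\mathrm{tr}(TM)$, orthogonal to $S(TM)$ and $S(TM^\perp)$, with $T\overline M|_M=TM\oplus l\mathrm{tr}(TM)\oplus S(TM^\perp)$. Let $\mathrm{tr}(TM)=l\mathrm{tr}(TM)\perp S(TM^\perp)$. For vector fields $X,Y$ tangent to $M$, $h^s(X,Y)$ is the $S(TM^\perp)$-component of $\overline\nabla_XY$ in this decomposition. Assume that $M$ is *screen real*: $U,V\in S(TM^\perp)$ along $M$, $J_a\mathrm{Rad}\,TM=\mathrm{Rad}\,TM$ and $J_aS(TM)\subset S(TM^\perp)$ for $a=1,2,3$. For $W\in S(TM^\perp)$ let $B_aW$ be the $TM$-component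 of $J_aW$ in $T\overline M|_M=TM\oplus\mathrm{tr}(TM)$. **Theorem.** For each $a\in\{1,2,3\}$, the distribution $\mathrm{Rad}\,TM$ is integrable (that is, $[\xi_1,\xi_2]\in\Gamma(\mathrm{Rad}\,TM)$ for all $\xi_1,\xi_2\in\Gamma(\mathrm{Rad}\,TM)$) if and only if $$B_ah^s(\xi_1,J_a\xi_2)=B_ah^s(\xi_2,J_a\xi_1)\qquad\text{for all }\xi_1,\xi_2\in\Gamma(\mathrm{Rad}\,TM).$$ (For $a=2,3$ the equality is required at each point of $M$ for the local tensors $J_a$ of every $\mathcal O_i$ containing that point.) -/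

import Mathlib

open Bundle Set Filter
open scoped Manifold ContDiff Topology

noncomputable section

/-! ### The real smooth structure underlying a complex manifold -/

/-- Every complex manifold is a smooth real manifold (for the same charts). -/
instance isManifold_real_of_complex {E : Type*} [NormedAddCommGroup E] [NormedSpace ℂ E]
    {M : Type*} [TopologicalSpace M] [ChartedSpace E M] [IsManifold 𝓘(ℂ, E) ω M] :
    IsManifold 𝓘(ℝ, E) ∞ M := by
  apply isManifold_of_contDiffOn
  intro e e' he he'
  have h := HasGroupoid.compatible (G := contDiffGroupoid ω 𝓘(ℂ, E)) he he'
  rw [contDiffGroupoid, mem_groupoid_of_pregroupoid] at h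
  have h1 : ContDiffOn ℂ ω (𝓘(ℂ, E) ∘ (e.symm ≫ₕ e') ∘ 𝓘(ℂ, E).symm)
    (𝓘(ℂ, E).symm ⁻¹' (e.symm ≫ₕ e').source ∩ range 𝓘(ℂ, E)) := h.1
  exact (h1.restrict_scalars ℝ).of_le le_top

/-- Multiplication by the imaginary unit on the tangent space of a complex manifold: its almost
complex structure `J`. (The preferred chart at `x` identifies the tangent space with `E`, and all
coordinate changes are complex linear.) -/
def complexJ {E : Type*} [NormedAddCommGroup E] [NormedSpace ℂ E]
    {M : Type*} [TopologicalSpace M] [ChartedSpace E M] (x : M) :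
    TangentSpace 𝓘(ℝ, E) x →L[ℝ] TangentSpace 𝓘(ℝ, E) x :=
  ((Complex.I • ContinuousLinearMap.id ℂ E).restrictScalars ℝ : E →L[ℝ] E)

/-- A real tangent vector of a complex manifold, seen in the holomorphic tangent space. -/
def toComplexTangent {E : Type*} [NormedAddCommGroup E] [NormedSpace ℂ E]
    {M : Type*} [TopologicalSpace M] [ChartedSpace E M] {x : M}
    (v : TangentSpace 𝓘(ℝ, E) x) : TangentSpace 𝓘(ℂ, E) x :=
  (v : E)

/-! ### One-forms, smooth sections -/

/-- The exterior derivative of a one-form, evaluated on vector fields, with the convention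
`2 dα(X, Y) = X (α Y) - Y (α X) - α [X, Y]`. -/
def oneFormD {𝕜 : Type*} [NontriviallyNormedField 𝕜]
    {E : Type*} [NormedAddCommGroup E] [NormedSpace 𝕜 E]
    {M : Type*} [TopologicalSpace M] [ChartedSpace E M]
    (α : Π x : M, TangentSpace 𝓘(𝕜, E) x →L[𝕜] 𝕜) (X Y : Π x : M, TangentSpace 𝓘(𝕜, E) x)
    (x : M) : 𝕜 :=
  (1 / 2 : 𝕜) *
    (mvfderiv 𝓘(𝕜, E) (fun y ↦ α y (Y y)) x (X x) - mvfderiv 𝓘(𝕜, E) (fun y ↦ α y (X y)) x (Y x)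
      - α x (VectorField.mlieBracket 𝓘(𝕜, E) X Y x))

/-- The wedge product of two covectors, `2 (α ∧ β)(v, w) = α(v) β(w) - α(w) β(v)`. -/
def covectorWedge {V : Type*} (α β : V → ℝ) (v w : V) : ℝ :=
  (1 / 2 : ℝ) * (α v * β w - α w * β v)

/-- The value of `α ∧ β ∧ ⋯ ∧ β` (`n` factors `β`) on `2n + 1` vectors, for a covector `α` and an
alternating two-form `β`, up to a positive normalizing constant. -/
def wedgePow {V : Type*} (n : ℕ) (α : V → ℂ) (β : V → V → ℂ) (w : Fin (2 * n + 1) → V) : ℂ :=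
  ∑ τ : Equiv.Perm (Fin (2 * n + 1)), ((Equiv.Perm.sign τ : ℤ) : ℂ) * α (w (τ 0)) *
    ∏ k : Fin n, β (w (τ ⟨2 * k + 1, by omega⟩)) (w (τ ⟨2 * k + 2, by omega⟩))

/-- The vector field `X` of `N` is smooth at `x`. -/
def SmoothFieldAt {E : Type*} [NormedAddCommGroup E] [NormedSpace ℝ E]
    {N : Type*} [TopologicalSpace N] [ChartedSpace E N] [IsManifold 𝓘(ℝ, E) ∞ N]
    (X : Π x : N, TangentSpace 𝓘(ℝ, E) x) (x : N) : Prop :=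
  ContMDiffAt 𝓘(ℝ, E) 𝓘(ℝ, E).tangent ∞
    (fun y ↦ (TotalSpace.mk' E y (X y) : TangentBundle 𝓘(ℝ, E) N)) x

/-- `Y`, a family of tangent vectors of `N` along `f : M → N`, is smooth on `O`. -/
def SmoothAlongOn {F : Type*} [NormedAddCommGroup F] [NormedSpace ℝ F]
    {M : Type*} [TopologicalSpace M] [ChartedSpace F M]
    {E : Type*} [NormedAddCommGroup E] [NormedSpace ℝ E]
    {N : Type*} [TopologicalSpace N] [ChartedSpace E N] [IsManifold 𝓘(ℝ, E) ∞ N]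
    (f : M → N) (Y : Π p : M, TangentSpace 𝓘(ℝ, E) (f p)) (O : Set M) : Prop :=
  ContMDiffOn 𝓘(ℝ, F) 𝓘(ℝ, E).tangent ∞
    (fun p ↦ (TotalSpace.mk' E (f p) (Y p) : TangentBundle 𝓘(ℝ, E) N)) O

/-- `D` is a smooth subbundle of rank `r` of the pull-back of `TN` under `f : M → N`: locally it is
spanned by `r` smooth pointwise linearly independent sections along `f`.
For `f` the identity this is a smooth distribution of rank `r`. -/
def IsSmoothSubbundle {F : Type*} [NormedAddCommGroup F] [NormedSpace ℝ F]
    {M : Type*} [TopologicalSpace M] [ChartedSpace F M]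
    {E : Type*} [NormedAddCommGroup E] [NormedSpace ℝ E]
    {N : Type*} [TopologicalSpace N] [ChartedSpace E N] [IsManifold 𝓘(ℝ, E) ∞ N]
    (f : M → N) (D : Π p : M, Submodule ℝ (TangentSpace 𝓘(ℝ, E) (f p))) (r : ℕ) : Prop :=
  ∀ p₀ : M, ∃ O : Set M, IsOpen O ∧ p₀ ∈ O ∧
    ∃ s : Fin r → Π p : M, TangentSpace 𝓘(ℝ, E) (f p),
      (∀ k, SmoothAlongOn (F := F) f (s k) O) ∧
      ∀ p ∈ O, LinearIndependent ℝ (fun k ↦ s k p) ∧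
        Submodule.span ℝ (range fun k ↦ s k p) = D p

/-- `X ∈ Γ(D)`: `X` is a smooth vector field on `M` with values in the distribution `D`. -/
def IsSectionOf {F : Type*} [NormedAddCommGroup F] [NormedSpace ℝ F]
    {M : Type*} [TopologicalSpace M] [ChartedSpace F M] [IsManifold 𝓘(ℝ, F) ∞ M]
    (D : Π p : M, Submodule ℝ (TangentSpace 𝓘(ℝ, F) p)) (X : Π p : M, TangentSpace 𝓘(ℝ, F) p) :
    Prop :=
  SmoothAlongOn (F := F) (fun p : M ↦ p) X univ ∧ ∀ p, X p ∈ D p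

/-- Integrability of a distribution: `[X, Y] ∈ Γ(D)` for all `X, Y ∈ Γ(D)`. -/
def IsIntegrableDistribution {F : Type*} [NormedAddCommGroup F] [NormedSpace ℝ F]
    {M : Type*} [TopologicalSpace M] [ChartedSpace F M] [IsManifold 𝓘(ℝ, F) ∞ M]
    (D : Π p : M, Submodule ℝ (TangentSpace 𝓘(ℝ, F) p)) : Prop :=
  ∀ X Y : Π p : M, TangentSpace 𝓘(ℝ, F) p, IsSectionOf D X → IsSectionOf D Y →
    ∀ p, VectorField.mlieBracket 𝓘(ℝ, F) X Y p ∈ D p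

/-! ### Semi-Riemannian metrics and the Levi-Civita connection -/

/-- A smooth semi-Riemannian metric. -/
structure SemiRiemannianMetric (E : Type*) [NormedAddCommGroup E] [NormedSpace ℝ E]
    (N : Type*) [TopologicalSpace N] [ChartedSpace E N] [IsManifold 𝓘(ℝ, E) ∞ N] where
  val : Π x : N, TangentSpace 𝓘(ℝ, E) x →L[ℝ] TangentSpace 𝓘(ℝ, E) x →L[ℝ] ℝ
  symm : ∀ x v w, val x v w = val x w v
  nondegenerate : ∀ x v, (∀ w, val x v w = 0) → v = 0
  contMDiff : ContMDiff 𝓘(ℝ, E) (𝓘(ℝ, E).prod 𝓘(ℝ, E →L[ℝ] E →L[ℝ] ℝ)) ∞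
    (fun x ↦ TotalSpace.mk' (E →L[ℝ] E →L[ℝ] ℝ)
      (E := fun x : N ↦ TangentSpace 𝓘(ℝ, E) x →L[ℝ] TangentSpace 𝓘(ℝ, E) x →L[ℝ] ℝ) x (val x))

namespace SemiRiemannianMetric

variable {E : Type*} [NormedAddCommGroup E] [NormedSpace ℝ E]
  {N : Type*} [TopologicalSpace N] [ChartedSpace E N] [IsManifold 𝓘(ℝ, E) ∞ N]

/-- The metric has constant index `ν`: at every point, `ν` is the largest dimension of a subspace
on which it is negative definite. -/
def HasIndex (g : SemiRiemannianMetric E N) (ν : ℕ) : Prop :=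
  ∀ x, IsGreatest {k : ℕ | ∃ P : Submodule ℝ (TangentSpace 𝓘(ℝ, E) x),
    Module.finrank ℝ P = k ∧ ∀ v ∈ P, v ≠ 0 → g.val x v v < 0} ν

/-- `∇` is the Levi-Civita connection of the metric, i.e. the torsion-free metric connection.
(In Mathlib `∇ Y x (X x)` is `(∇_X Y)(x)`.) -/
structure IsLeviCivita (g : SemiRiemannianMetric E N)
    (cov : CovariantDerivative 𝓘(ℝ, E) E (TangentSpace 𝓘(ℝ, E) : N → Type _)) : Prop where
  torsion_free : ∀ (X Y : Π x : N, TangentSpace 𝓘(ℝ, E) x) (x : N),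
    MDifferentiableAt 𝓘(ℝ, E) 𝓘(ℝ, E).tangent
      (fun y ↦ (TotalSpace.mk' E y (X y) : TangentBundle 𝓘(ℝ, E) N)) x →
    MDifferentiableAt 𝓘(ℝ, E) 𝓘(ℝ, E).tangent
      (fun y ↦ (TotalSpace.mk' E y (Y y) : TangentBundle 𝓘(ℝ, E) N)) x →
    cov Y x (X x) - cov X x (Y x) = VectorField.mlieBracket 𝓘(ℝ, E) X Y x
  metric : ∀ (Y Z : Π x : N, TangentSpace 𝓘(ℝ, E) x) (x : N) (v : TangentSpace 𝓘(ℝ, E) x),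
    MDifferentiableAt 𝓘(ℝ, E) 𝓘(ℝ, E).tangent
      (fun y ↦ (TotalSpace.mk' E y (Y y) : TangentBundle 𝓘(ℝ, E) N)) x →
    MDifferentiableAt 𝓘(ℝ, E) 𝓘(ℝ, E).tangent
      (fun y ↦ (TotalSpace.mk' E y (Z y) : TangentBundle 𝓘(ℝ, E) N)) x →
    mvfderiv 𝓘(ℝ, E) (fun y ↦ g.val y (Y y) (Z y)) x v
      = g.val x (cov Y x v) (Z x) + g.val x (Y x) (cov Z x v)

end SemiRiemannianMetric

/-- The covariant derivative along `f : M → N` (pull-back connection): in the local frame `e_k` of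
`TN` given by the trivialization at `f p`, a section `Y = ∑ Y^k e_k` along `f` has
`∇_v Y = ∑ Y^k(p) ∇_{df v} e_k + ∑ dY^k(v) e_k(f p)`. -/
def covAlong {F : Type*} [NormedAddCommGroup F] [NormedSpace ℝ F]
    {M : Type*} [TopologicalSpace M] [ChartedSpace F M]
    {E : Type*} [NormedAddCommGroup E] [NormedSpace ℝ E]
    {N : Type*} [TopologicalSpace N] [ChartedSpace E N] [IsManifold 𝓘(ℝ, E) ∞ N]
    (cov : CovariantDerivative 𝓘(ℝ, E) E (TangentSpace 𝓘(ℝ, E) : N → Type _))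
    (f : M → N) (Y : Π p : M, TangentSpace 𝓘(ℝ, E) (f p)) (p : M)
    (v : TangentSpace 𝓘(ℝ, F) p) : TangentSpace 𝓘(ℝ, E) (f p) :=
  let t := trivializationAt E (TangentSpace 𝓘(ℝ, E) : N → Type _) (f p)
  cov (FiberBundle.extend E (Y p)) (f p) (mfderiv 𝓘(ℝ, F) 𝓘(ℝ, E) f p v)
    + t.symmL ℝ (f p) (mvfderiv 𝓘(ℝ, F) (fun q ↦ (t (TotalSpace.mk' E (f q) (Y q))).2) p v)

/-- For the restriction to `M` of a vector field of `N`, the covariant derivative along `f` is the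
covariant derivative of `N`. -/
theorem covAlong_comp {F : Type*} [NormedAddCommGroup F] [NormedSpace ℝ F]
    {M : Type*} [TopologicalSpace M] [ChartedSpace F M]
    {E : Type*} [NormedAddCommGroup E] [NormedSpace ℝ E] [FiniteDimensional ℝ E]
    {N : Type*} [TopologicalSpace N] [ChartedSpace E N] [IsManifold 𝓘(ℝ, E) ∞ N]
    (cov : CovariantDerivative 𝓘(ℝ, E) E (TangentSpace 𝓘(ℝ, E) : N → Type _))
    (f : M → N) (Y : Π x : N, TangentSpace 𝓘(ℝ, E) x) (p : M)
    (hf : MDifferentiableAt 𝓘(ℝ, F) 𝓘(ℝ, E) f p)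
    (hY : MDifferentiableAt 𝓘(ℝ, E) 𝓘(ℝ, E).tangent
      (fun y ↦ (TotalSpace.mk' E y (Y y) : TangentBundle 𝓘(ℝ, E) N)) (f p))
    (v : TangentSpace 𝓘(ℝ, F) p) :
    covAlong cov f (fun q ↦ Y (f q)) p v = cov Y (f p) (mfderiv 𝓘(ℝ, F) 𝓘(ℝ, E) f p v) := by
  let t := trivializationAt E (TangentSpace 𝓘(ℝ, E) : N → Type _) (f p)
  have hmem : f p ∈ t.baseSet := FiberBundle.mem_baseSet_trivializationAt' (f p)
  have hnhds : ∀ᶠ y in 𝓝 (f p), y ∈ t.baseSet := t.open_baseSet.mem_nhds hmem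
  let w := mfderiv 𝓘(ℝ, F) 𝓘(ℝ, E) f p v
  let c (X : Π x : N, TangentSpace 𝓘(ℝ, E) x) (y : N) : E := (t (TotalSpace.mk' E y (X y))).2
  have hc : ∀ X : Π x : N, TangentSpace 𝓘(ℝ, E) x,
      MDifferentiableAt 𝓘(ℝ, E) 𝓘(ℝ, E).tangent
        (fun y ↦ (TotalSpace.mk' E y (X y) : TangentBundle 𝓘(ℝ, E) N)) (f p) →
      MDifferentiableAt 𝓘(ℝ, E) 𝓘(ℝ, E) (c X) (f p) :=
    fun X hX ↦ (mdifferentiableAt_section _ _).1 hX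
  have hcval : ∀ (X : Π x : N, TangentSpace 𝓘(ℝ, E) x) (y : N), y ∈ t.baseSet →
      c X y = t.linearMapAt ℝ y (X y) := fun X y hy ↦ by
    simp [c, t.linearMapAt_apply, hy]
  have hsymm : ∀ (X : Π x : N, TangentSpace 𝓘(ℝ, E) x), t.symmL ℝ (f p) (c X (f p)) = X (f p) :=
    fun X ↦ by
    rw [hcval X _ hmem]
    exact t.symmL_continuousLinearMapAt (R := ℝ) hmem _
  have htens : TensorialAt 𝓘(ℝ, E) E (fun X : Π x : N, TangentSpace 𝓘(ℝ, E) x ↦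
      cov X (f p) w - t.symmL ℝ (f p) (mvfderiv 𝓘(ℝ, E) (c X) (f p) w)) (f p) := by
    constructor
    · intro φ X hφ hX
      have h1 : c (φ • X) =ᶠ[𝓝 (f p)] φ • c X := by
        filter_upwards [hnhds] with y hy
        rw [hcval _ y hy, Pi.smul_apply', Pi.smul_apply', hcval _ y hy, map_smul]
      have h2 : mvfderiv 𝓘(ℝ, E) (c (φ • X)) (f p) = mvfderiv 𝓘(ℝ, E) (φ • c X) (f p) := by
        simp only [mvfderiv]
        rw [h1.mfderiv_eq, h1.eq_of_nhds]
      rw [h2, mvfderiv_smul hφ (hc X hX), cov.isCovariantDerivativeOnUniv.leibniz hX hφ]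
      simp only [add_apply, smul_apply,
        ContinuousLinearMap.smulRight_apply, map_add, map_smul, hsymm]
      module
    · intro X X' hX hX'
      have h1 : c (X + X') =ᶠ[𝓝 (f p)] c X + c X' := by
        filter_upwards [hnhds] with y hy
        rw [hcval _ y hy, Pi.add_apply, Pi.add_apply, hcval _ y hy, hcval _ y hy, map_add]
      have h2 : mvfderiv 𝓘(ℝ, E) (c (X + X')) (f p) = mvfderiv 𝓘(ℝ, E) (c X + c X') (f p) := by
        simp only [mvfderiv]
        rw [h1.mfderiv_eq, h1.eq_of_nhds]
      rw [h2, mvfderiv_add (hc X hX) (hc X' hX'), cov.isCovariantDerivativeOnUniv.add hX hX']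
      simp only [add_apply, map_add]
      abel
  have hext := FiberBundle.mdifferentiableAt_extend 𝓘(ℝ, E) E (Y (f p))
  have key := htens.pointwise hY hext (by simp)
  have hconst : mvfderiv 𝓘(ℝ, E) (c (FiberBundle.extend E (Y (f p)))) (f p) = 0 := by
    have h1 : c (FiberBundle.extend E (Y (f p))) =ᶠ[𝓝 (f p)] fun _ ↦ c Y (f p) := by
      filter_upwards [hnhds] with y hy
      change (t (TotalSpace.mk' E y (t.symm y (c Y (f p))))).2 = c Y (f p)
      rw [t.apply_mk_symm hy]
    have h2 : mvfderiv 𝓘(ℝ, E) (c (FiberBundle.extend E (Y (f p)))) (f p)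
        = mvfderiv 𝓘(ℝ, E) (fun _ : N ↦ c Y (f p)) (f p) := by
      simp only [mvfderiv]
      rw [h1.mfderiv_eq, h1.eq_of_nhds]
    rw [h2, mvfderiv_const]
  have hchain : mvfderiv 𝓘(ℝ, F) (fun q ↦ c Y (f q)) p v = mvfderiv 𝓘(ℝ, E) (c Y) (f p) w := by
    have h := mfderiv_comp_apply p (hc Y hY) hf v
    exact h
  change cov (FiberBundle.extend E (Y (f p))) (f p) w
    + t.symmL ℝ (f p) (mvfderiv 𝓘(ℝ, F) (fun q ↦ c Y (f q)) p v) = cov Y (f p) w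
  rw [hchain]
  simp only [hconst] at key
  rw [zero_apply, map_zero, sub_zero] at key
  rw [← key]
  abel

/-! ### Complex contact metric manifolds -/

/-- A complex contact structure on a complex manifold of complex dimension `2n + 1`: an open
covering with holomorphic one-forms `θ i`, `θ i ∧ (dθ i)^n ≠ 0`, which on overlaps differ by
nowhere vanishing holomorphic functions. -/
structure ComplexContactStructure (ι : Type*) (n : ℕ)
    (E : Type*) [NormedAddCommGroup E] [NormedSpace ℂ E]
    (N : Type*) [TopologicalSpace N] [ChartedSpace E N] [IsManifold 𝓘(ℂ, E) ω N] where
  finrank_eq : Module.finrank ℂ E = 2 * n + 1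
  O : ι → Set N
  isOpen_O : ∀ i, IsOpen (O i)
  cover : ∀ x, ∃ i, x ∈ O i
  θ : ι → Π x : N, TangentSpace 𝓘(ℂ, E) x →L[ℂ] ℂ
  holomorphic_θ : ∀ i, ContMDiffOn 𝓘(ℂ, E) (𝓘(ℂ, E).prod 𝓘(ℂ, E →L[ℂ] ℂ)) ω
    (fun x ↦ TotalSpace.mk' (E →L[ℂ] ℂ)
      (E := fun x : N ↦ TangentSpace 𝓘(ℂ, E) x →L[ℂ] ℂ) x (θ i x)) (O i)
  contact : ∀ i, ∀ x ∈ O i, ∃ w : Fin (2 * n + 1) → TangentSpace 𝓘(ℂ, E) x,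
    wedgePow n (fun v ↦ θ i x v)
      (fun v w ↦ oneFormD (θ i) (FiberBundle.extend E v) (FiberBundle.extend E w) x) w ≠ 0
  transition : ∀ i j, ∃ φ : N → ℂ, ContMDiffOn 𝓘(ℂ, E) 𝓘(ℂ, ℂ) ω φ (O i ∩ O j) ∧
    ∀ x ∈ O i ∩ O j, φ x ≠ 0 ∧ θ i x = φ x • θ j x

/-- A complex contact metric structure `(u, v, U, V, G, H, g)` on a complex contact manifold, where
`v = u ∘ J`, `V = -J U`, `H = G J`, and `g` is a semi-Riemannian Hermitian metric. The tensors are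
local, defined on the sets `O i`; values outside of `O i` are irrelevant. -/
structure ComplexContactMetricStructure (ι : Type*) (n : ℕ)
    (E : Type*) [NormedAddCommGroup E] [NormedSpace ℂ E]
    (N : Type*) [TopologicalSpace N] [ChartedSpace E N] [IsManifold 𝓘(ℂ, E) ω N] extends ComplexContactStructure ι n E N where
  g : SemiRiemannianMetric E N
  hermitian : ∀ x v w, g.val x (complexJ x v) (complexJ x w) = g.val x v w
  u : ι → Π x : N, TangentSpace 𝓘(ℝ, E) x →L[ℝ] ℝ
  U : ι → Π x : N, TangentSpace 𝓘(ℝ, E) x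
  G : ι → Π x : N, TangentSpace 𝓘(ℝ, E) x →L[ℝ] TangentSpace 𝓘(ℝ, E) x
  /-- the one-form `σ` in the structure equations for `du` and `dv` -/
  σ : ι → Π x : N, TangentSpace 𝓘(ℝ, E) x →L[ℝ] ℝ
  smooth_u : ∀ i, ContMDiffOn 𝓘(ℝ, E) (𝓘(ℝ, E).prod 𝓘(ℝ, E →L[ℝ] ℝ)) ∞
    (fun x ↦ TotalSpace.mk' (E →L[ℝ] ℝ)
      (E := fun x : N ↦ TangentSpace 𝓘(ℝ, E) x →L[ℝ] ℝ) x (u i x)) (O i)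
  smooth_U : ∀ i, SmoothAlongOn (F := E) (fun x : N ↦ x) (U i) (O i)
  smooth_G : ∀ i, ContMDiffOn 𝓘(ℝ, E) (𝓘(ℝ, E).prod 𝓘(ℝ, E →L[ℝ] E)) ∞
    (fun x ↦ TotalSpace.mk' (E →L[ℝ] E)
      (E := fun x : N ↦ TangentSpace 𝓘(ℝ, E) x →L[ℝ] TangentSpace 𝓘(ℝ, E) x) x (G i x)) (O i)
  smooth_σ : ∀ i, ContMDiffOn 𝓘(ℝ, E) (𝓘(ℝ, E).prod 𝓘(ℝ, E →L[ℝ] ℝ)) ∞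
    (fun x ↦ TotalSpace.mk' (E →L[ℝ] ℝ)
      (E := fun x : N ↦ TangentSpace 𝓘(ℝ, E) x →L[ℝ] ℝ) x (σ i x)) (O i)
  G_sq : ∀ i, ∀ x ∈ O i, ∀ X, G i x (G i x X)
    = -X + u i x X • U i x + u i x (complexJ x X) • (-complexJ x (U i x))
  H_sq : ∀ i, ∀ x ∈ O i, ∀ X, G i x (complexJ x (G i x (complexJ x X)))
    = -X + u i x X • U i x + u i x (complexJ x X) • (-complexJ x (U i x))
  G_skew : ∀ i, ∀ x ∈ O i, ∀ X Y, g.val x (G i x X) Y = -g.val x X (G i x Y)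
  g_U : ∀ i, ∀ x ∈ O i, ∀ X, g.val x (U i x) X = u i x X
  G_J : ∀ i, ∀ x ∈ O i, ∀ X, G i x (complexJ x X) = -complexJ x (G i x X)
  G_U : ∀ i, ∀ x ∈ O i, G i x (U i x) = 0
  u_U : ∀ i, ∀ x ∈ O i, u i x (U i x) = 1
  /-- On overlaps, `u_j = a u_i - b v_i`, `v_j = b u_i + a v_i`, `G_j = a G_i - b H_i`,
  `H_j = b G_i + a H_i` with `a² + b² = 1`. -/
  overlap : ∀ i j, ∃ a b : N → ℝ, ∀ x ∈ O i ∩ O j, a x ^ 2 + b x ^ 2 = 1 ∧ ∀ X,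
    u j x X = a x * u i x X - b x * u i x (complexJ x X) ∧
    u j x (complexJ x X) = b x * u i x X + a x * u i x (complexJ x X) ∧
    G j x X = a x • G i x X - b x • G i x (complexJ x X) ∧
    G j x (complexJ x X) = b x • G i x X + a x • G i x (complexJ x X)
  /-- The contact form is a nowhere vanishing multiple of `u - √-1 v`. -/
  θ_eq : ∀ i, ∀ x ∈ O i, ∃ c : ℂ, c ≠ 0 ∧ ∀ X : TangentSpace 𝓘(ℝ, E) x,
    θ i x (toComplexTangent X)
      = c * ((u i x X : ℂ) - Complex.I * (u i x (complexJ x X) : ℂ))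
  /-- `du(X, Y) = g(X, G Y) + (σ ∧ v)(X, Y)` -/
  du_eq : ∀ i, ∀ x ∈ O i, ∀ X Y : Π y : N, TangentSpace 𝓘(ℝ, E) y,
    SmoothFieldAt X x →
    SmoothFieldAt Y x →
    oneFormD (u i) X Y x = g.val x (X x) (G i x (Y x))
      + covectorWedge (σ i x) (fun w ↦ u i x (complexJ x w)) (X x) (Y x)
  /-- `dv(X, Y) = g(X, H Y) - (σ ∧ u)(X, Y)` -/
  dv_eq : ∀ i, ∀ x ∈ O i, ∀ X Y : Π y : N, TangentSpace 𝓘(ℝ, E) y,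
    SmoothFieldAt X x →
    SmoothFieldAt Y x →
    oneFormD (fun y ↦ (u i y).comp (complexJ y)) X Y x
      = g.val x (X x) (G i x (complexJ x (Y x)))
        - covectorWedge (σ i x) (u i x) (X x) (Y x)

/-- The Nijenhuis tensor `[A, A](X, Y) = A²[X, Y] + [AX, AY] - A[AX, Y] - A[X, AY]`. -/
def nijenhuis {E : Type*} [NormedAddCommGroup E] [NormedSpace ℝ E]
    {N : Type*} [TopologicalSpace N] [ChartedSpace E N]
    (A : Π x : N, TangentSpace 𝓘(ℝ, E) x →L[ℝ] TangentSpace 𝓘(ℝ, E) x)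
    (X Y : Π x : N, TangentSpace 𝓘(ℝ, E) x) (x : N) : TangentSpace 𝓘(ℝ, E) x :=
  A x (A x (VectorField.mlieBracket 𝓘(ℝ, E) X Y x))
    + VectorField.mlieBracket 𝓘(ℝ, E) (fun y ↦ A y (X y)) (fun y ↦ A y (Y y)) x
    - A x (VectorField.mlieBracket 𝓘(ℝ, E) (fun y ↦ A y (X y)) Y x)
    - A x (VectorField.mlieBracket 𝓘(ℝ, E) X (fun y ↦ A y (Y y)) x)

namespace ComplexContactMetricStructure

variable {ι : Type*} {n : ℕ}
  {E : Type*} [NormedAddCommGroup E] [NormedSpace ℂ E]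
  {N : Type*} [TopologicalSpace N] [ChartedSpace E N] [IsManifold 𝓘(ℂ, E) ω N]

/-- `v = u ∘ J` -/
def v (C : ComplexContactMetricStructure ι n E N) (i : ι) (x : N) :
    TangentSpace 𝓘(ℝ, E) x →L[ℝ] ℝ :=
  (C.u i x).comp (complexJ x)

/-- `V = -J U` -/
def V (C : ComplexContactMetricStructure ι n E N) (i : ι) (x : N) : TangentSpace 𝓘(ℝ, E) x :=
  -complexJ x (C.U i x)

/-- `H = G J` -/
def H (C : ComplexContactMetricStructure ι n E N) (i : ι) (x : N) :
    TangentSpace 𝓘(ℝ, E) x →L[ℝ] TangentSpace 𝓘(ℝ, E) x :=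
  (C.G i x).comp (complexJ x)

/-- `J₁ = J`, `J₂ = G`, `J₃ = H`. -/
def Ja (C : ComplexContactMetricStructure ι n E N) (a : Fin 3) (i : ι) (x : N) :
    TangentSpace 𝓘(ℝ, E) x →L[ℝ] TangentSpace 𝓘(ℝ, E) x :=
  match a with
  | 0 => complexJ x
  | 1 => C.G i x
  | 2 => C.H i x

/-- The tensor field `S` of a complex contact metric structure. -/
def tensorS (C : ComplexContactMetricStructure ι n E N) (i : ι)
    (X Y : Π x : N, TangentSpace 𝓘(ℝ, E) x) (x : N) : TangentSpace 𝓘(ℝ, E) x :=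
  nijenhuis (C.G i) X Y x + (2 * C.g.val x (X x) (C.G i x (Y x))) • C.U i x
    - (2 * C.g.val x (X x) (C.H i x (Y x))) • C.V i x
    + (2 : ℝ) • (C.v i x (Y x) • C.H i x (X x) - C.v i x (X x) • C.H i x (Y x))
    + C.σ i x (C.G i x (Y x)) • C.H i x (X x) - C.σ i x (C.G i x (X x)) • C.H i x (Y x)
    + C.σ i x (X x) • C.G i x (C.H i x (Y x)) - C.σ i x (Y x) • C.G i x (C.H i x (X x))

/-- The tensor field `T` of a complex contact metric structure. -/
def tensorT (C : ComplexContactMetricStructure ι n E N) (i : ι)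
    (X Y : Π x : N, TangentSpace 𝓘(ℝ, E) x) (x : N) : TangentSpace 𝓘(ℝ, E) x :=
  nijenhuis (C.H i) X Y x - (2 * C.g.val x (X x) (C.G i x (Y x))) • C.U i x
    + (2 * C.g.val x (X x) (C.H i x (Y x))) • C.V i x
    + (2 : ℝ) • (C.u i x (Y x) • C.G i x (X x) - C.u i x (X x) • C.G i x (Y x))
    + C.σ i x (C.H i x (X x)) • C.G i x (Y x) - C.σ i x (C.H i x (Y x)) • C.G i x (X x)
    + C.σ i x (X x) • C.G i x (C.H i x (Y x)) - C.σ i x (Y x) • C.G i x (C.H i x (X x))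

/-- `X` is horizontal (a section of the contact subbundle, the kernel of `u - √-1 v`) near `x`. -/
def HorizontalNear (C : ComplexContactMetricStructure ι n E N) (i : ι)
    (X : Π x : N, TangentSpace 𝓘(ℝ, E) x) (x : N) : Prop :=
  ∀ᶠ y in 𝓝 x, C.u i y (X y) = 0 ∧ C.v i y (X y) = 0

/-- Normality: `S(X, Y) = T(X, Y) = 0` for horizontal `X, Y`, and `S(U, X) = T(V, X) = 0` for all
`X`. -/
structure IsNormal (C : ComplexContactMetricStructure ι n E N) : Prop where
  horizontal : ∀ i, ∀ x ∈ C.O i, ∀ X Y : Π y : N, TangentSpace 𝓘(ℝ, E) y,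
    SmoothFieldAt X x → SmoothFieldAt Y x → C.HorizontalNear i X x → C.HorizontalNear i Y x →
    C.tensorS i X Y x = 0 ∧ C.tensorT i X Y x = 0
  vertical : ∀ i, ∀ x ∈ C.O i, ∀ X : Π y : N, TangentSpace 𝓘(ℝ, E) y,
    SmoothFieldAt X x → C.tensorS i (C.U i) X x = 0 ∧ C.tensorT i (C.V i) X x = 0

end ComplexContactMetricStructure

/-! ### Null submanifolds -/

/-- The radical distribution of an immersion `f` into a semi-Riemannian manifold,
`Rad T_pM = T_pM ∩ T_pM^⊥`, as a subspace of `T_pM`. -/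
def radicalAt {E : Type*} [NormedAddCommGroup E] [NormedSpace ℝ E]
    {N : Type*} [TopologicalSpace N] [ChartedSpace E N] [IsManifold 𝓘(ℝ, E) ∞ N]
    (g : SemiRiemannianMetric E N)
    {F : Type*} [NormedAddCommGroup F] [NormedSpace ℝ F]
    {M : Type*} [TopologicalSpace M] [ChartedSpace F M]
    (f : M → N) (p : M) : Submodule ℝ (TangentSpace 𝓘(ℝ, F) p) where
  carrier := {v | ∀ w : TangentSpace 𝓘(ℝ, F) p,
    g.val (f p) (mfderiv 𝓘(ℝ, F) 𝓘(ℝ, E) f p v) (mfderiv 𝓘(ℝ, F) 𝓘(ℝ, E) f p w) = 0}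
  zero_mem' := by intro w; simp
  add_mem' := by intro a b ha hb w; simp [ha w, hb w]
  smul_mem' := by intro c a ha w; simp [ha w]

/-- The normal space `T_pM^⊥`, a subspace of the tangent space of the ambient manifold. -/
def normalAt {E : Type*} [NormedAddCommGroup E] [NormedSpace ℝ E]
    {N : Type*} [TopologicalSpace N] [ChartedSpace E N] [IsManifold 𝓘(ℝ, E) ∞ N]
    (g : SemiRiemannianMetric E N)
    {F : Type*} [NormedAddCommGroup F] [NormedSpace ℝ F]
    {M : Type*} [TopologicalSpace M] [ChartedSpace F M]
    (f : M → N) (p : M) : Submodule ℝ (TangentSpace 𝓘(ℝ, E) (f p)) where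
  carrier := {z | ∀ w : TangentSpace 𝓘(ℝ, F) p,
    g.val (f p) z (mfderiv 𝓘(ℝ, F) 𝓘(ℝ, E) f p w) = 0}
  zero_mem' := by intro w; simp
  add_mem' := by intro a b ha hb w; simp [ha w, hb w]
  smul_mem' := by intro c a ha w; simp [ha w]

/-- A null (lightlike) submanifold of a semi-Riemannian manifold, given by an immersion `f`, together
with a choice of a screen distribution `S(TM)`, a screen transversal bundle `S(TM^⊥)` and a null
transversal bundle `ltr(TM)`. (Complements of the radical are automatically nondegenerate.) -/
structure NullSubmanifold {E : Type*} [NormedAddCommGroup E] [NormedSpace ℝ E]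
    {N : Type*} [TopologicalSpace N] [ChartedSpace E N] [IsManifold 𝓘(ℝ, E) ∞ N]
    (g : SemiRiemannianMetric E N)
    (F : Type*) [NormedAddCommGroup F] [NormedSpace ℝ F]
    (M : Type*) [TopologicalSpace M] [ChartedSpace F M] [IsManifold 𝓘(ℝ, F) ∞ M] where
  f : M → N
  smooth_f : ContMDiff 𝓘(ℝ, F) 𝓘(ℝ, E) ∞ f
  immersion_f : ∀ p, Function.Injective (mfderiv 𝓘(ℝ, F) 𝓘(ℝ, E) f p)
  /-- the rank of the radical distribution -/
  r : ℕ
  r_pos : 0 < r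
  radical_smooth : IsSmoothSubbundle (F := F) (fun p : M ↦ p) (radicalAt g (F := F) f) r
  /-- the screen distribution `S(TM)` -/
  screen : Π p : M, Submodule ℝ (TangentSpace 𝓘(ℝ, F) p)
  screen_smooth : ∃ k, IsSmoothSubbundle (F := F) (fun p : M ↦ p) screen k
  isCompl_screen : ∀ p, IsCompl (radicalAt g f p) (screen p)
  /-- the screen transversal bundle `S(TM^⊥)` -/
  screenT : Π p : M, Submodule ℝ (TangentSpace 𝓘(ℝ, E) (f p))
  screenT_smooth : ∃ k, IsSmoothSubbundle (F := F) f screenT k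
  screenT_disjoint : ∀ p, Disjoint
    ((radicalAt g f p).map (mfderiv 𝓘(ℝ, F) 𝓘(ℝ, E) f p).toLinearMap) (screenT p)
  screenT_sup : ∀ p,
    (radicalAt g f p).map (mfderiv 𝓘(ℝ, F) 𝓘(ℝ, E) f p).toLinearMap ⊔ screenT p
      = normalAt g (F := F) f p
  /-- the null transversal bundle `ltr(TM)` -/
  ltr : Π p : M, Submodule ℝ (TangentSpace 𝓘(ℝ, E) (f p))
  ltr_smooth : ∃ k, IsSmoothSubbundle (F := F) f ltr k
  ltr_null : ∀ p, ∀ z ∈ ltr p, ∀ z' ∈ ltr p, g.val (f p) z z' = 0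
  ltr_screen : ∀ p, ∀ z ∈ ltr p, ∀ w ∈ screen p,
    g.val (f p) z (mfderiv 𝓘(ℝ, F) 𝓘(ℝ, E) f p w) = 0
  ltr_screenT : ∀ p, ∀ z ∈ ltr p, ∀ w ∈ screenT p, g.val (f p) z w = 0
  /-- `T_{f p}N = T_pM ⊕ ltr(TM)_p ⊕ S(TM^⊥)_p`, in two steps -/
  tangent_disjoint_ltr : ∀ p,
    Disjoint (mfderiv 𝓘(ℝ, F) 𝓘(ℝ, E) f p).toLinearMap.range (ltr p)
  isCompl_screenT : ∀ p,
    IsCompl (screenT p) ((mfderiv 𝓘(ℝ, F) 𝓘(ℝ, E) f p).toLinearMap.range ⊔ ltr p)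

namespace NullSubmanifold

variable {E : Type*} [NormedAddCommGroup E] [NormedSpace ℝ E]
  {N : Type*} [TopologicalSpace N] [ChartedSpace E N] [IsManifold 𝓘(ℝ, E) ∞ N]
  {g : SemiRiemannianMetric E N}
  {F : Type*} [NormedAddCommGroup F] [NormedSpace ℝ F]
  {M : Type*} [TopologicalSpace M] [ChartedSpace F M] [IsManifold 𝓘(ℝ, F) ∞ M]

/-- The image of a tangent vector of `M` in the ambient tangent space. -/
def push (S : NullSubmanifold g F M) (p : M) :
    TangentSpace 𝓘(ℝ, F) p →L[ℝ] TangentSpace 𝓘(ℝ, E) (S.f p) :=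
  mfderiv 𝓘(ℝ, F) 𝓘(ℝ, E) S.f p

/-- `T_pM` as a subspace of the ambient tangent space. -/
def tangent (S : NullSubmanifold g F M) (p : M) : Submodule ℝ (TangentSpace 𝓘(ℝ, E) (S.f p)) :=
  (S.push p).toLinearMap.range

/-- The transversal bundle `tr(TM) = ltr(TM) ⊥ S(TM^⊥)`. -/
def tr (S : NullSubmanifold g F M) (p : M) : Submodule ℝ (TangentSpace 𝓘(ℝ, E) (S.f p)) :=
  S.ltr p ⊔ S.screenT p

/-- The radical distribution `Rad TM`. -/
def rad (S : NullSubmanifold g F M) (p : M) : Submodule ℝ (TangentSpace 𝓘(ℝ, F) p) :=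
  radicalAt g S.f p

theorem isCompl_tangent_tr (S : NullSubmanifold g F M) (p : M) :
    IsCompl (S.tangent p) (S.tr p) := by
  have h1 : Disjoint (S.tangent p) (S.ltr p) := S.tangent_disjoint_ltr p
  have h2 : IsCompl (S.screenT p) (S.tangent p ⊔ S.ltr p) := S.isCompl_screenT p
  refine ⟨?_, ?_⟩
  · exact h1.disjoint_sup_right_of_disjoint_sup_left h2.disjoint.symm
  · rw [codisjoint_iff]
    have h3 := h2.sup_eq_top
    rw [sup_comm, sup_assoc] at h3
    exact h3

/-- The tangential part of an ambient vector, for the decomposition `TM ⊕ tr(TM)`. -/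
def tangentialPart (S : NullSubmanifold g F M) (p : M) :
    TangentSpace 𝓘(ℝ, E) (S.f p) →ₗ[ℝ] TangentSpace 𝓘(ℝ, E) (S.f p) :=
  (S.tangent p).projection (S.tr p) (S.isCompl_tangent_tr p)

/-- The `S(TM^⊥)`-part of an ambient vector, for the decomposition `TM ⊕ ltr(TM) ⊕ S(TM^⊥)`. -/
def screenTPart (S : NullSubmanifold g F M) (p : M) :
    TangentSpace 𝓘(ℝ, E) (S.f p) →ₗ[ℝ] TangentSpace 𝓘(ℝ, E) (S.f p) :=
  (S.screenT p).projection (S.tangent p ⊔ S.ltr p) (S.isCompl_screenT p)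

/-- `h^s(X, Y)`, the `S(TM^⊥)`-component of `∇̄_X Y` in the Gauss formula
`∇̄_X Y = ∇_X Y + h^l(X, Y) + h^s(X, Y)`; here `∇̄` is `cov`, and the vector field `Y`, tangent to
`M`, is given as a field of ambient vectors along the immersion. -/
def hs (S : NullSubmanifold g F M)
    (cov : CovariantDerivative 𝓘(ℝ, E) E (TangentSpace 𝓘(ℝ, E) : N → Type _))
    (X : Π p : M, TangentSpace 𝓘(ℝ, F) p) (Y : Π p : M, TangentSpace 𝓘(ℝ, E) (S.f p)) (p : M) :
    TangentSpace 𝓘(ℝ, E) (S.f p) :=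
  S.screenTPart p (covAlong cov S.f Y p (X p))

end NullSubmanifold

namespace ComplexContactMetricStructure

variable {ι : Type*} {n : ℕ}
  {E : Type*} [NormedAddCommGroup E] [NormedSpace ℂ E]
  {N : Type*} [TopologicalSpace N] [ChartedSpace E N] [IsManifold 𝓘(ℂ, E) ω N]
  {F : Type*} [NormedAddCommGroup F] [NormedSpace ℝ F]
  {M : Type*} [TopologicalSpace M] [ChartedSpace F M] [IsManifold 𝓘(ℝ, F) ∞ M]

/-- Screen real null submanifolds: the characteristic subbundle spanned by `U, V` lies in
`S(TM^⊥)`, and `J_a Rad TM = Rad TM`, `J_a S(TM) ⊆ S(TM^⊥)` for `a = 1, 2, 3`. -/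
structure IsScreenReal (C : ComplexContactMetricStructure ι n E N)
    (S : NullSubmanifold C.g F M) : Prop where
  U_mem : ∀ i p, S.f p ∈ C.O i → C.U i (S.f p) ∈ S.screenT p
  V_mem : ∀ i p, S.f p ∈ C.O i → C.V i (S.f p) ∈ S.screenT p
  map_rad : ∀ a i p, S.f p ∈ C.O i →
    ((S.rad p).map (S.push p).toLinearMap).map (C.Ja a i (S.f p)).toLinearMap
      = (S.rad p).map (S.push p).toLinearMap
  map_screen : ∀ a i p, S.f p ∈ C.O i →
    ((S.screen p).map (S.push p).toLinearMap).map (C.Ja a i (S.f p)).toLinearMap ≤ S.screenT p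

/-- `B_a W`, the tangential part of `J_a W`. -/
def Ba (C : ComplexContactMetricStructure ι n E N) (S : NullSubmanifold C.g F M)
    (a : Fin 3) (i : ι) (p : M) (W : TangentSpace 𝓘(ℝ, E) (S.f p)) :
    TangentSpace 𝓘(ℝ, E) (S.f p) :=
  S.tangentialPart p (C.Ja a i (S.f p) W)

end ComplexContactMetricStructure

end

/-!
Since `U` and `V` are sections of `S(TM^⊥)`, they are normal to `M`: all tangent vectors of a
screen real null submanifold are horizontal, that is, annihilated by `u` and `v`. The theorem
follows from one fact about the ambient manifold: for horizontal `X`, `Y`, up to combinations of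
`U` and `V`,

`(∇_X G) Y = σ(X) H Y`, `(∇_X H) Y = -σ(X) G Y`, `(∇_X J) Y = 0`.

Granted this (`ComplexContactMetricStructure.IsNormal.covEnd_Ja`), let `ξ₁`, `ξ₂` be sections of
`Rad TM` and write `[ξ₁, ξ₂] = ρ + z` with `ρ` in the radical and `z` in the screen distribution.
The connection pulled back to `M` is torsion-free (`covAlong_sub_covAlong`) and satisfies the
Leibniz rule for the tensors `J_a` (`covAlong_endo_apply`), so `∇_{ξ₁} J_a ξ₂ - ∇_{ξ₂} J_a ξ₁` is
the sum of `J_a (ρ + z)`, of multiples of vectors `J_b ξ₁`, `J_b ξ₂`, and of a combination of `U`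
and `V`. The vectors `J_a ρ`, `J_b ξ₁` and `J_b ξ₂` are tangent to `M`, while `J_a z`, `U` and `V`
lie in `S(TM^⊥)`. As `J_a` maps combinations of `U` and `V` to such combinations and `J_a² z = -z`,
this gives `B_a h^s(ξ₁, J_a ξ₂) - B_a h^s(ξ₂, J_a ξ₁) = -z` (`IsScreenReal.Ba_hs_sub`). The
left-hand side vanishes if and only if `[ξ₁, ξ₂]` is radical.

The formulas for `∇G` and `∇H` are two instances of `IsNormalContactPair.metric_covEnd`, for
`(u, v, σ, G, H)` and for `(v, u, -σ, H, G)`. Put `D(X, Y, Z) = g((∇_X G) Y - σ(X) H Y, Z)` for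
horizontal vectors. It is skew in `Y`, `Z`; its cyclic sum vanishes because `d²u = 0`, which here
is the Jacobi identity for horizontal fields; and `S = 0` on horizontal fields expresses the
Nijenhuis tensor of `G` and becomes `D(GX, Y, Z) - D(GY, X, Z) - D(Y, X, GZ) + D(X, Y, GZ) = 0`.
Linear algebra gives `D(GX, Y, Z) = 0`, and `G` is onto the horizontal vectors. The formula for
`∇J` follows from `H = G J`.
-/

/-! ### Lie brackets as commutators of derivations -/

section

/-- In a normed space a Lie bracket acts on `C²` functions as the commutator of derivations: the
second derivatives cancel by symmetry. -/
theorem fderiv_lieBracket {E : Type*} [NormedAddCommGroup E] [NormedSpace ℝ E]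
    {E' : Type*} [NormedAddCommGroup E'] [NormedSpace ℝ E'] {φ : E → E'} {V W : E → E} {z : E}
    (hφ : ContDiffAt ℝ 2 φ z) (hV : DifferentiableAt ℝ V z) (hW : DifferentiableAt ℝ W z) :
    fderiv ℝ φ z (VectorField.lieBracket ℝ V W z)
      = fderiv ℝ (fun y ↦ fderiv ℝ φ y (W y)) z (V z)
        - fderiv ℝ (fun y ↦ fderiv ℝ φ y (V y)) z (W z) := by
  have hd : DifferentiableAt ℝ (fderiv ℝ φ) z :=
    (hφ.fderiv_right (m := 1) (by norm_num)).differentiableAt (by norm_num)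
  have hsymm : fderiv ℝ (fderiv ℝ φ) z (V z) (W z) = fderiv ℝ (fderiv ℝ φ) z (W z) (V z) :=
    hφ.isSymmSndFDerivAt (by simp) (V z) (W z)
  rw [fderiv_clm_apply hd hV, fderiv_clm_apply hd hW, VectorField.lieBracket]
  simp [hsymm]

variable {F : Type*} [NormedAddCommGroup F] [NormedSpace ℝ F]
  {M : Type*} [TopologicalSpace M] [ChartedSpace F M]
  {E : Type*} [NormedAddCommGroup E] [NormedSpace ℝ E]

/-- The derivative of a vector valued function on a manifold, computed in a chart. -/
theorem mvfderiv_eq_fderiv_comp_extChartAt_symm [IsManifold 𝓘(ℝ, F) 1 M] {h : M → E} {x y : M}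
    (hy : y ∈ (chartAt F x).source)
    (hh : MDifferentiableAt 𝓘(ℝ, F) 𝓘(ℝ, E) h y) (v : TangentSpace 𝓘(ℝ, F) y) :
    mvfderiv 𝓘(ℝ, F) h y v = fderiv ℝ (h ∘ (extChartAt 𝓘(ℝ, F) x).symm) (extChartAt 𝓘(ℝ, F) x y)
      (mfderiv 𝓘(ℝ, F) 𝓘(ℝ, F) (extChartAt 𝓘(ℝ, F) x) y v) := by
  have hy' : y ∈ (extChartAt 𝓘(ℝ, F) x).source := by simpa using hy
  set e := extChartAt 𝓘(ℝ, F) x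
  have he : MDifferentiableAt 𝓘(ℝ, F) 𝓘(ℝ, F) e y := mdifferentiableAt_extChartAt hy
  have hs : MDifferentiableAt 𝓘(ℝ, F) 𝓘(ℝ, F) e.symm (e y) :=
    (mdifferentiableOn_extChartAt_symm (e y) (e.map_source hy')).mdifferentiableAt
      (extChartAt_target_mem_nhds' (e.map_source hy'))
  have hsy : e.symm (e y) = y := e.left_inv hy'
  have hh' : MDifferentiableAt 𝓘(ℝ, F) 𝓘(ℝ, E) (h ∘ e.symm) (e y) :=
    MDifferentiableAt.comp (e y) (by rwa [hsy]) hs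
  have h1 : h =ᶠ[𝓝 y] (h ∘ e.symm) ∘ e := by
    filter_upwards [extChartAt_source_mem_nhds' hy'] with q hq
    exact congrArg h (e.left_inv hq).symm
  have h2 : mfderiv 𝓘(ℝ, F) 𝓘(ℝ, E) ((h ∘ e.symm) ∘ e) y v
    = fderiv ℝ (h ∘ e.symm) (e y) (mfderiv 𝓘(ℝ, F) 𝓘(ℝ, F) e y v) :=
    (mfderiv_comp_apply y hh' he v).trans
      (congrArg (fun L : F →L[ℝ] E ↦ L (mfderiv 𝓘(ℝ, F) 𝓘(ℝ, F) e y v))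
        (mfderiv_eq_fderiv (f := h ∘ e.symm) (x := e y)))
  refine Eq.trans ?_ h2
  exact congrArg (fun L : F →L[ℝ] E ↦ L v) h1.mfderiv_eq

theorem mpullbackWithin_extChartAt_symm [IsManifold 𝓘(ℝ, F) ∞ M]
    (X : Π x : M, TangentSpace 𝓘(ℝ, F) x) {x y : M} (hy : y ∈ (chartAt F x).source) :
    VectorField.mpullbackWithin 𝓘(ℝ, F) 𝓘(ℝ, F) (extChartAt 𝓘(ℝ, F) x).symm X
        (range 𝓘(ℝ, F)) (extChartAt 𝓘(ℝ, F) x y)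
      = mfderiv 𝓘(ℝ, F) 𝓘(ℝ, F) (extChartAt 𝓘(ℝ, F) x) y (X y) := by
  have hy' : y ∈ (extChartAt 𝓘(ℝ, F) x).source := by simpa using hy
  have hinv := isInvertible_mfderivWithin_extChartAt_symm (I := 𝓘(ℝ, F))
    ((extChartAt 𝓘(ℝ, F) x).map_source hy')
  have hl : (extChartAt 𝓘(ℝ, F) x).symm (extChartAt 𝓘(ℝ, F) x y) = y :=
    (extChartAt 𝓘(ℝ, F) x).left_inv hy'
  rw [VectorField.mpullbackWithin_apply, hinv.inverse_apply_eq]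
  have h := mfderivWithin_extChartAt_symm_comp_mfderiv_extChartAt' (I := 𝓘(ℝ, F)) hy'
  have h2 := congrArg (fun L : F →L[ℝ] F ↦ L (X y)) h
  refine Eq.trans ?_ h2.symm
  exact congrArg (fun q ↦ (X q : F)) hl

/-- The Lie bracket of vector fields on a manifold acts on `C²` functions as the commutator of
derivations. -/
theorem mvfderiv_mlieBracket [CompleteSpace F] [IsManifold 𝓘(ℝ, F) ∞ M] {φ : M → E} {x : M}
    {X Y : Π x : M, TangentSpace 𝓘(ℝ, F) x}
    (hφ : ContMDiffAt 𝓘(ℝ, F) 𝓘(ℝ, E) 2 φ x)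
    (hX : MDifferentiableAt 𝓘(ℝ, F) 𝓘(ℝ, F).tangent
      (fun y ↦ (TotalSpace.mk' F y (X y) : TangentBundle 𝓘(ℝ, F) M)) x)
    (hY : MDifferentiableAt 𝓘(ℝ, F) 𝓘(ℝ, F).tangent
      (fun y ↦ (TotalSpace.mk' F y (Y y) : TangentBundle 𝓘(ℝ, F) M)) x) :
    mvfderiv 𝓘(ℝ, F) φ x (VectorField.mlieBracket 𝓘(ℝ, F) X Y x)
      = mvfderiv 𝓘(ℝ, F) (fun y ↦ mvfderiv 𝓘(ℝ, F) φ y (Y y)) x (X x)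
        - mvfderiv 𝓘(ℝ, F) (fun y ↦ mvfderiv 𝓘(ℝ, F) φ y (X y)) x (Y x) := by
  set e := extChartAt 𝓘(ℝ, F) x
  have hφ1 : ∀ᶠ y in 𝓝 x, MDifferentiableAt 𝓘(ℝ, F) 𝓘(ℝ, E) φ y := by
    filter_upwards [(contMDiffAt_iff_contMDiffAt_nhds (n := 2) (by simp)).1 hφ] with y hy
      using hy.mdifferentiableAt (by simp)
  have hφ' : ContDiffAt ℝ 2 (φ ∘ e.symm) (e x) := by
    rw [← contMDiffAt_iff_contDiffAt]
    refine ContMDiffAt.comp (e x) (I' := 𝓘(ℝ, F))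
      (by rwa [e.left_inv (mem_extChartAt_source x)]) ?_
    exact (contMDiffOn_extChartAt_symm (n := 2) x).contMDiffAt (extChartAt_target_mem_nhds x)
  -- the vector field `Z` in the chart at `x`
  let c (Z : Π x : M, TangentSpace 𝓘(ℝ, F) x) : F → F :=
    VectorField.mpullbackWithin 𝓘(ℝ, F) 𝓘(ℝ, F) e.symm Z (range 𝓘(ℝ, F))
  have hc : ∀ Z : Π x : M, TangentSpace 𝓘(ℝ, F) x, ∀ y ∈ (chartAt F x).source,
      c Z (e y) = mfderiv 𝓘(ℝ, F) 𝓘(ℝ, F) e y (Z y) :=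
    fun Z y hy ↦ mpullbackWithin_extChartAt_symm Z hy
  have hdiff : ∀ Z : Π x : M, TangentSpace 𝓘(ℝ, F) x,
      MDifferentiableAt 𝓘(ℝ, F) 𝓘(ℝ, F).tangent
        (fun y ↦ (TotalSpace.mk' F y (Z y) : TangentBundle 𝓘(ℝ, F) M)) x →
      DifferentiableAt ℝ (c Z) (e x) := by
    intro Z hZ
    have h : DifferentiableWithinAt ℝ (c Z) (e.symm ⁻¹' univ ∩ range 𝓘(ℝ, F)) (e x) :=
      hZ.mdifferentiableWithinAt.differentiableWithinAt_mpullbackWithin_vectorField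
    rwa [preimage_univ, univ_inter, modelWithCornersSelf_coe, range_id,
      differentiableWithinAt_univ] at h
  have hbr : VectorField.lieBracket ℝ (c X) (c Y) (e x)
      = mfderiv 𝓘(ℝ, F) 𝓘(ℝ, F) e x (VectorField.mlieBracket 𝓘(ℝ, F) X Y x) := by
    have hinv := isInvertible_mfderiv_extChartAt (I := 𝓘(ℝ, F))
      (mem_extChartAt_source (I := 𝓘(ℝ, F)) x)
    refine hinv.inverse_apply_eq.1 ?_
    rw [VectorField.mlieBracket, VectorField.mlieBracketWithin_apply]
    have : (e.symm ⁻¹' univ ∩ range 𝓘(ℝ, F)) = univ := by simp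
    rw [← VectorField.lieBracketWithin_univ, ← this]
  have hfun : ∀ Z : Π x : M, TangentSpace 𝓘(ℝ, F) x, ∀ w,
      MDifferentiableAt 𝓘(ℝ, F) 𝓘(ℝ, F).tangent
        (fun y ↦ (TotalSpace.mk' F y (Z y) : TangentBundle 𝓘(ℝ, F) M)) x →
      mvfderiv 𝓘(ℝ, F) (fun y ↦ mvfderiv 𝓘(ℝ, F) φ y (Z y)) x w
      = fderiv ℝ (fun z ↦ fderiv ℝ (φ ∘ e.symm) z (c Z z)) (e x)
          (mfderiv 𝓘(ℝ, F) 𝓘(ℝ, F) e x w) := by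
    intro Z w hZ
    have h1 : (fun y ↦ mvfderiv 𝓘(ℝ, F) φ y (Z y)) =ᶠ[𝓝 x]
        (fun z ↦ fderiv ℝ (φ ∘ e.symm) z (c Z z)) ∘ e := by
      filter_upwards [hφ1, (chartAt F x).open_source.mem_nhds (mem_chart_source F x)] with y hy hy'
      rw [mvfderiv_eq_fderiv_comp_extChartAt_symm hy' hy]
      simp only [Function.comp_apply]
      rw [hc Z y hy']
    have hd : DifferentiableAt ℝ (fun z ↦ fderiv ℝ (φ ∘ e.symm) z (c Z z)) (e x) :=
      ((hφ'.fderiv_right (m := 1) (by norm_num)).differentiableAt (by norm_num)).clm_apply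
        (hdiff Z hZ)
    have h2 := (mfderiv_comp_apply x hd.mdifferentiableAt
      (mdifferentiableAt_extChartAt (I := 𝓘(ℝ, F)) (mem_chart_source F x)) w).trans
      (congrArg (fun L : F →L[ℝ] E ↦ L (mfderiv 𝓘(ℝ, F) 𝓘(ℝ, F) e x w)) mfderiv_eq_fderiv)
    refine Eq.trans ?_ h2
    exact congrArg (fun L : F →L[ℝ] E ↦ L w) h1.mfderiv_eq
  have key := fderiv_lieBracket hφ' (hdiff X hX) (hdiff Y hY)
  rw [mvfderiv_eq_fderiv_comp_extChartAt_symm (mem_chart_source F x) hφ1.self_of_nhds,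
    hfun Y _ hY, hfun X _ hX, ← hbr, ← hc X x (mem_chart_source F x),
    ← hc Y x (mem_chart_source F x)]
  exact key

end

/-! ### Torsion of the pull-back connection -/

section

variable {F : Type*} [NormedAddCommGroup F] [NormedSpace ℝ F]
  {M : Type*} [TopologicalSpace M] [ChartedSpace F M]
  {E : Type*} [NormedAddCommGroup E] [NormedSpace ℝ E]
  {N : Type*} [TopologicalSpace N] [ChartedSpace E N] [IsManifold 𝓘(ℝ, E) ∞ N]

/-- The trivialization of the tangent bundle at `x` is the derivative of the chart at `x`. -/
theorem trivializationAt_snd {x y : N} (hy : y ∈ (chartAt E x).source)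
    (v : TangentSpace 𝓘(ℝ, E) y) :
    (trivializationAt E (TangentSpace 𝓘(ℝ, E) : N → Type _) x (TotalSpace.mk' E y v)).2
      = mvfderiv 𝓘(ℝ, E) (extChartAt 𝓘(ℝ, E) x) y v := by
  have h := TangentBundle.continuousLinearMapAt_trivializationAt (I := 𝓘(ℝ, E)) hy
  have h2 := congrArg (fun L : E →L[ℝ] E ↦ L v) h
  refine Eq.trans ?_ h2
  have hb : y ∈ (trivializationAt E (TangentSpace 𝓘(ℝ, E) : N → Type _) x).baseSet := hy
  have h3 : (trivializationAt E (TangentSpace 𝓘(ℝ, E) : N → Type _) x).continuousLinearMapAt ℝ y v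
      = (trivializationAt E (TangentSpace 𝓘(ℝ, E) : N → Type _) x (TotalSpace.mk' E y v)).2 := by
    rw [Trivialization.continuousLinearMapAt_apply, Trivialization.linearMapAt_apply, if_pos hb]
  exact h3.symm

/-- The extension of a tangent vector used by `FiberBundle.extend` has constant coordinates in the
chart. -/
theorem trivializationAt_extend_snd {x y : N} (hy : y ∈ (chartAt E x).source)
    (v : TangentSpace 𝓘(ℝ, E) x) :
    (trivializationAt E (TangentSpace 𝓘(ℝ, E) : N → Type _) x
      (TotalSpace.mk' E y (FiberBundle.extend E v y))).2
      = (trivializationAt E (TangentSpace 𝓘(ℝ, E) : N → Type _) x (TotalSpace.mk' E x v)).2 := by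
  have hb : y ∈ (trivializationAt E (TangentSpace 𝓘(ℝ, E) : N → Type _) x).baseSet := hy
  change (trivializationAt E (TangentSpace 𝓘(ℝ, E) : N → Type _) x (TotalSpace.mk' E y
    ((trivializationAt E (TangentSpace 𝓘(ℝ, E) : N → Type _) x).symm y _))).2 = _
  rw [Trivialization.apply_mk_symm _ hb]

/-- Coordinate vector fields commute. -/
theorem mlieBracket_extend [CompleteSpace E] {x : N} (v w : TangentSpace 𝓘(ℝ, E) x) :
    VectorField.mlieBracket 𝓘(ℝ, E) (FiberBundle.extend E v : Π y : N, TangentSpace 𝓘(ℝ, E) y)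
      (FiberBundle.extend E w) x = 0 := by
  have hsrc : ∀ᶠ y in 𝓝 x, y ∈ (chartAt E x).source :=
    (chartAt E x).open_source.mem_nhds (mem_chart_source E x)
  have hconst : ∀ (a : TangentSpace 𝓘(ℝ, E) x) (b : TangentSpace 𝓘(ℝ, E) x),
      mvfderiv 𝓘(ℝ, E) (fun y ↦ mvfderiv 𝓘(ℝ, E) (extChartAt 𝓘(ℝ, E) x) y
        (FiberBundle.extend E a y)) x b = 0 := by
    intro a b
    have h1 : (fun y ↦ mvfderiv 𝓘(ℝ, E) (extChartAt 𝓘(ℝ, E) x) y (FiberBundle.extend E a y))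
        =ᶠ[𝓝 x] fun _ ↦ (trivializationAt E (TangentSpace 𝓘(ℝ, E) : N → Type _) x
          (TotalSpace.mk' E x a)).2 := by
      filter_upwards [hsrc] with y hy
      rw [← trivializationAt_snd hy, trivializationAt_extend_snd hy]
    have h2 := mvfderiv_const (I := 𝓘(ℝ, E)) (x := x)
      (trivializationAt E (TangentSpace 𝓘(ℝ, E) : N → Type _) x (TotalSpace.mk' E x a)).2
    refine Eq.trans ?_ (congrArg (fun L : E →L[ℝ] E ↦ L b) h2)
    exact congrArg (fun L : E →L[ℝ] E ↦ L b) h1.mfderiv_eq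
  have key := mvfderiv_mlieBracket (φ := extChartAt 𝓘(ℝ, E) x) (x := x)
    (contMDiffAt_extChartAt (n := 2)) (FiberBundle.mdifferentiableAt_extend 𝓘(ℝ, E) E v)
    (FiberBundle.mdifferentiableAt_extend 𝓘(ℝ, E) E w)
  rw [hconst, hconst, sub_zero] at key
  have hinv := isInvertible_mfderiv_extChartAt (I := 𝓘(ℝ, E))
      (mem_extChartAt_source (I := 𝓘(ℝ, E)) x)
  exact hinv.injective (key.trans (map_zero (mvfderiv 𝓘(ℝ, E) (extChartAt 𝓘(ℝ, E) x) x)).symm)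

/-- The pull-back of a torsion-free connection under a map `f` is torsion-free:
`∇_X (f_* Y) - ∇_Y (f_* X) = f_* [X, Y]`. In the chart at `f p` the Christoffel terms cancel, and
what remains is the bracket `[X, Y]` acting on the components of `f`. -/
theorem covAlong_sub_covAlong [CompleteSpace E] [CompleteSpace F] [IsManifold 𝓘(ℝ, F) ∞ M]
    {g : SemiRiemannianMetric E N}
    {cov : CovariantDerivative 𝓘(ℝ, E) E (TangentSpace 𝓘(ℝ, E) : N → Type _)}
    (hcov : g.IsLeviCivita cov) {f : M → N} {p : M} (hf : ContMDiffAt 𝓘(ℝ, F) 𝓘(ℝ, E) 2 f p)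
    {X Y : Π x : M, TangentSpace 𝓘(ℝ, F) x}
    (hX : MDifferentiableAt 𝓘(ℝ, F) 𝓘(ℝ, F).tangent
      (fun y ↦ (TotalSpace.mk' F y (X y) : TangentBundle 𝓘(ℝ, F) M)) p)
    (hY : MDifferentiableAt 𝓘(ℝ, F) 𝓘(ℝ, F).tangent
      (fun y ↦ (TotalSpace.mk' F y (Y y) : TangentBundle 𝓘(ℝ, F) M)) p) :
    covAlong cov f (fun q ↦ mfderiv 𝓘(ℝ, F) 𝓘(ℝ, E) f q (Y q)) p (X p)
      - covAlong cov f (fun q ↦ mfderiv 𝓘(ℝ, F) 𝓘(ℝ, E) f q (X q)) p (Y p)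
      = mfderiv 𝓘(ℝ, F) 𝓘(ℝ, E) f p (VectorField.mlieBracket 𝓘(ℝ, F) X Y p) := by
  have hsrc : ∀ᶠ q in 𝓝 p, f q ∈ (chartAt E (f p)).source :=
    hf.continuousAt ((chartAt E (f p)).open_source.mem_nhds (mem_chart_source E (f p)))
  have hf1 : ∀ᶠ q in 𝓝 p, MDifferentiableAt 𝓘(ℝ, F) 𝓘(ℝ, E) f q := by
    filter_upwards [(contMDiffAt_iff_contMDiffAt_nhds (n := 2) (by simp)).1 hf] with y hy
      using hy.mdifferentiableAt (by simp)
  set t := trivializationAt E (TangentSpace 𝓘(ℝ, E) : N → Type _) (f p)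
  have hmem : f p ∈ t.baseSet := FiberBundle.mem_baseSet_trivializationAt' (f p)
  set φ : M → E := extChartAt 𝓘(ℝ, E) (f p) ∘ f
  have hchain : ∀ (q : M) (w : TangentSpace 𝓘(ℝ, F) q), f q ∈ (chartAt E (f p)).source →
      MDifferentiableAt 𝓘(ℝ, F) 𝓘(ℝ, E) f q →
      mvfderiv 𝓘(ℝ, E) (extChartAt 𝓘(ℝ, E) (f p)) (f q) (mfderiv 𝓘(ℝ, F) 𝓘(ℝ, E) f q w)
        = mvfderiv 𝓘(ℝ, F) φ q w := by
    intro q w hq hfq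
    exact (mfderiv_comp_apply q (mdifferentiableAt_extChartAt (I := 𝓘(ℝ, E)) hq) hfq w).symm
  have hφ2 : ContMDiffAt 𝓘(ℝ, F) 𝓘(ℝ, E) 2 φ p :=
    ContMDiffAt.comp p (contMDiffAt_extChartAt (n := 2)) hf
  have hder : ∀ (Z : Π x : M, TangentSpace 𝓘(ℝ, F) x) (w : TangentSpace 𝓘(ℝ, F) p),
      mvfderiv 𝓘(ℝ, F) (fun q ↦ (t (TotalSpace.mk' E (f q)
        (mfderiv 𝓘(ℝ, F) 𝓘(ℝ, E) f q (Z q)))).2) p w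
      = mvfderiv 𝓘(ℝ, F) (fun q ↦ mvfderiv 𝓘(ℝ, F) φ q (Z q)) p w := by
    intro Z w
    have h1 : (fun q ↦ (t (TotalSpace.mk' E (f q)
        (mfderiv 𝓘(ℝ, F) 𝓘(ℝ, E) f q (Z q)))).2) =ᶠ[𝓝 p]
        fun q ↦ mvfderiv 𝓘(ℝ, F) φ q (Z q) := by
      filter_upwards [hsrc, hf1] with q hq hfq
      rw [← hchain q _ hq hfq]
      exact trivializationAt_snd hq _
    exact congrArg (fun L : F →L[ℝ] E ↦ L w) h1.mfderiv_eq
  have key := mvfderiv_mlieBracket hφ2 hX hY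
  rw [← hder, ← hder, ← hchain p _ (mem_chart_source E (f p)) hf1.self_of_nhds,
    ← trivializationAt_snd (mem_chart_source E (f p))] at key
  -- the Christoffel terms are symmetric
  have htor : ∀ a b : TangentSpace 𝓘(ℝ, E) (f p),
      cov (FiberBundle.extend E b) (f p) a - cov (FiberBundle.extend E a) (f p) b = 0 := by
    intro a b
    have h := hcov.torsion_free (FiberBundle.extend E a) (FiberBundle.extend E b) (f p)
      (FiberBundle.mdifferentiableAt_extend 𝓘(ℝ, E) E a)
      (FiberBundle.mdifferentiableAt_extend 𝓘(ℝ, E) E b)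
    rwa [FiberBundle.extend_apply_self, FiberBundle.extend_apply_self, mlieBracket_extend] at h
  have hsymm : ∀ a : TangentSpace 𝓘(ℝ, E) (f p),
      t.symmL ℝ (f p) (t (TotalSpace.mk' E (f p) a)).2 = a := by
    intro a
    have h2 := t.symmL_continuousLinearMapAt (R := ℝ) hmem a
    rwa [Trivialization.continuousLinearMapAt_apply, Trivialization.linearMapAt_apply,
      if_pos hmem] at h2
  simp only [covAlong]
  rw [add_sub_add_comm, htor, zero_add, ← map_sub]
  exact (congrArg (t.symmL ℝ (f p)) key.symm).trans (hsymm _)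

end

/-! ### Covariant derivatives of fields of endomorphisms -/

section

variable {F : Type*} [NormedAddCommGroup F] [NormedSpace ℝ F]
  {M : Type*} [TopologicalSpace M] [ChartedSpace F M]
  {E : Type*} [NormedAddCommGroup E] [NormedSpace ℝ E]
  {N : Type*} [TopologicalSpace N] [ChartedSpace E N] [IsManifold 𝓘(ℝ, E) ∞ N]

theorem MDifferentiableAt.comp_extChartAt_symm [IsManifold 𝓘(ℝ, F) ∞ M] {h : M → E} {p : M}
    (hh : MDifferentiableAt 𝓘(ℝ, F) 𝓘(ℝ, E) h p) :
    DifferentiableAt ℝ (h ∘ (extChartAt 𝓘(ℝ, F) p).symm) (extChartAt 𝓘(ℝ, F) p p) := by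
  rw [← mdifferentiableAt_iff_differentiableAt]
  refine MDifferentiableAt.comp _ (I' := 𝓘(ℝ, F)) (by rwa [extChartAt_to_inv]) ?_
  exact (mdifferentiableOn_extChartAt_symm _ (mem_extChartAt_target p)).mdifferentiableAt
    (extChartAt_target_mem_nhds p)

/-- Leibniz rule for the evaluation of an operator valued function at a vector valued one. -/
theorem mvfderiv_clm_apply {E' : Type*} [NormedAddCommGroup E'] [NormedSpace ℝ E']
    [IsManifold 𝓘(ℝ, F) ∞ M] {Φ : M → E →L[ℝ] E'} {c : M → E} {p : M}
    (hΦ : MDifferentiableAt 𝓘(ℝ, F) 𝓘(ℝ, E →L[ℝ] E') Φ p)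
    (hc : MDifferentiableAt 𝓘(ℝ, F) 𝓘(ℝ, E) c p) (v : TangentSpace 𝓘(ℝ, F) p) :
    mvfderiv 𝓘(ℝ, F) (fun q ↦ Φ q (c q)) p v
      = mvfderiv 𝓘(ℝ, F) Φ p v (c p) + Φ p (mvfderiv 𝓘(ℝ, F) c p v) := by
  have hp := mem_chart_source F p
  have hl : (extChartAt 𝓘(ℝ, F) p).symm (extChartAt 𝓘(ℝ, F) p p) = p := extChartAt_to_inv p
  rw [mvfderiv_eq_fderiv_comp_extChartAt_symm hp (hΦ.clm_apply hc),
    mvfderiv_eq_fderiv_comp_extChartAt_symm hp hΦ, mvfderiv_eq_fderiv_comp_extChartAt_symm hp hc]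
  have h := fderiv_clm_apply hΦ.comp_extChartAt_symm hc.comp_extChartAt_symm
  rw [Function.comp_apply, Function.comp_apply, hl] at h
  have h2 := congrArg (fun L : F →L[ℝ] E' ↦
    L (mfderiv 𝓘(ℝ, F) 𝓘(ℝ, F) (extChartAt 𝓘(ℝ, F) p) p v)) h
  exact h2.trans (add_comm _ _)

/-- The field `A` of endomorphisms of the tangent spaces is differentiable at `x`, as a section of
the bundle of endomorphisms. -/
def MDifferentiableEndAt (A : Π x : N, TangentSpace 𝓘(ℝ, E) x →L[ℝ] TangentSpace 𝓘(ℝ, E) x)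
    (x : N) : Prop :=
  MDifferentiableAt 𝓘(ℝ, E) (𝓘(ℝ, E).prod 𝓘(ℝ, E →L[ℝ] E))
    (fun x ↦ TotalSpace.mk' (E →L[ℝ] E)
      (E := fun x : N ↦ TangentSpace 𝓘(ℝ, E) x →L[ℝ] TangentSpace 𝓘(ℝ, E) x) x (A x)) x

/-- The covariant derivative `(∇_w A) y` of a field `A` of endomorphisms of the tangent spaces. The
vector `y` is extended to a vector field with constant coordinates in the chart at `x`; where `A` is
differentiable any other extension gives the same value, see `cov_endo_apply`. -/
noncomputable def covEnd (cov : CovariantDerivative 𝓘(ℝ, E) E (TangentSpace 𝓘(ℝ, E) : N → Type _))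
    (A : Π x : N, TangentSpace 𝓘(ℝ, E) x →L[ℝ] TangentSpace 𝓘(ℝ, E) x) (x : N)
    (w y : TangentSpace 𝓘(ℝ, E) x) : TangentSpace 𝓘(ℝ, E) x :=
  cov (fun z ↦ A z (FiberBundle.extend E y z)) x w - A x (cov (FiberBundle.extend E y) x w)

theorem covAlong_id [FiniteDimensional ℝ E]
    (cov : CovariantDerivative 𝓘(ℝ, E) E (TangentSpace 𝓘(ℝ, E) : N → Type _))
    {Y : Π x : N, TangentSpace 𝓘(ℝ, E) x} {x : N}
    (hY : MDifferentiableAt 𝓘(ℝ, E) 𝓘(ℝ, E).tangent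
      (fun y ↦ (TotalSpace.mk' E y (Y y) : TangentBundle 𝓘(ℝ, E) N)) x)
    (w : TangentSpace 𝓘(ℝ, E) x) :
    covAlong cov (fun z : N ↦ z) Y x w = cov Y x w := by
  have h := covAlong_comp cov (fun z : N ↦ z) Y x mdifferentiableAt_id hY w
  rw [h]
  have : mfderiv 𝓘(ℝ, E) 𝓘(ℝ, E) (fun z : N ↦ z) x = ContinuousLinearMap.id ℝ _ := mfderiv_id
  rw [this]
  rfl

/-- Leibniz rule along a map `f`: `∇_v (A Y) = (∇_{f_* v} A) Y + A (∇_v Y)` for vectors `Y` along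
`f`. -/
theorem covAlong_endo_apply [FiniteDimensional ℝ E] [IsManifold 𝓘(ℝ, F) ∞ M]
    (cov : CovariantDerivative 𝓘(ℝ, E) E (TangentSpace 𝓘(ℝ, E) : N → Type _))
    {A : Π x : N, TangentSpace 𝓘(ℝ, E) x →L[ℝ] TangentSpace 𝓘(ℝ, E) x} {f : M → N} {p : M}
    (hA : MDifferentiableEndAt A (f p))
    {Y : Π p : M, TangentSpace 𝓘(ℝ, E) (f p)}
    (hf : MDifferentiableAt 𝓘(ℝ, F) 𝓘(ℝ, E) f p)
    (hY : MDifferentiableAt 𝓘(ℝ, F) 𝓘(ℝ, E).tangent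
      (fun p ↦ (TotalSpace.mk' E (f p) (Y p) : TangentBundle 𝓘(ℝ, E) N)) p)
    (v : TangentSpace 𝓘(ℝ, F) p) :
    covAlong cov f (fun q ↦ A (f q) (Y q)) p v
      = covEnd cov A (f p) (mfderiv 𝓘(ℝ, F) 𝓘(ℝ, E) f p v) (Y p)
        + A (f p) (covAlong cov f Y p v) := by
  set t := trivializationAt E (TangentSpace 𝓘(ℝ, E) : N → Type _) (f p)
  have hmem : f p ∈ t.baseSet := FiberBundle.mem_baseSet_trivializationAt' (f p)
  have hnhds : ∀ᶠ y in 𝓝 (f p), y ∈ t.baseSet := t.open_baseSet.mem_nhds hmem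
  have hclm : ∀ y ∈ t.baseSet, ∀ a : TangentSpace 𝓘(ℝ, E) y,
      t.continuousLinearMapAt ℝ y a = (t (TotalSpace.mk' E y a)).2 := fun y hy a ↦ by
    rw [Trivialization.continuousLinearMapAt_apply, Trivialization.linearMapAt_apply, if_pos hy]
  -- the matrix of `A` in the chart at `f p`
  let Ahat : N → E →L[ℝ] E := fun y ↦ (t.continuousLinearMapAt ℝ y).comp ((A y).comp (t.symmL ℝ y))
  have hAhat : MDifferentiableAt 𝓘(ℝ, E) 𝓘(ℝ, E →L[ℝ] E) Ahat (f p) :=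
    ((mdifferentiableAt_hom_bundle _).1 hA).2
  have hAapp : ∀ y ∈ t.baseSet, ∀ a : TangentSpace 𝓘(ℝ, E) y,
      (t (TotalSpace.mk' E y (A y a))).2 = Ahat y (t (TotalSpace.mk' E y a)).2 := by
    intro y hy a
    have h := t.symmL_continuousLinearMapAt (R := ℝ) hy a
    rw [← hclm y hy, ← hclm y hy]
    exact congrArg (fun b ↦ t.continuousLinearMapAt ℝ y (A y b)) h.symm
  have hAsymm : ∀ e : E, t.symmL ℝ (f p) (Ahat (f p) e) = A (f p) (t.symmL ℝ (f p) e) := fun e ↦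
    t.symmL_continuousLinearMapAt (R := ℝ) hmem _
  have hc : MDifferentiableAt 𝓘(ℝ, F) 𝓘(ℝ, E) (fun q ↦ (t (TotalSpace.mk' E (f q) (Y q))).2) p :=
    ((mdifferentiableAt_totalSpace _ _).1 hY).2
  have h1 : mvfderiv 𝓘(ℝ, F) (fun q ↦ (t (TotalSpace.mk' E (f q) (A (f q) (Y q)))).2) p v
      = mvfderiv 𝓘(ℝ, E) Ahat (f p) (mfderiv 𝓘(ℝ, F) 𝓘(ℝ, E) f p v)
          (t (TotalSpace.mk' E (f p) (Y p))).2
        + Ahat (f p) (mvfderiv 𝓘(ℝ, F) (fun q ↦ (t (TotalSpace.mk' E (f q) (Y q))).2) p v) := by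
    have h2 : (fun q ↦ (t (TotalSpace.mk' E (f q) (A (f q) (Y q)))).2) =ᶠ[𝓝 p]
        fun q ↦ (Ahat ∘ f) q (t (TotalSpace.mk' E (f q) (Y q))).2 := by
      filter_upwards [hf.continuousAt hnhds] with q hq using hAapp (f q) hq (Y q)
    have h3 := mvfderiv_clm_apply (Φ := Ahat ∘ f) (hAhat.comp p hf) hc v
    have h4 : mvfderiv 𝓘(ℝ, F) (Ahat ∘ f) p v
        = mvfderiv 𝓘(ℝ, E) Ahat (f p) (mfderiv 𝓘(ℝ, F) 𝓘(ℝ, E) f p v) :=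
      mfderiv_comp_apply p hAhat hf v
    rw [h4] at h3
    refine Eq.trans ?_ h3
    exact congrArg (fun L : F →L[ℝ] E ↦ L v) h2.mfderiv_eq
  have hext := FiberBundle.mdifferentiableAt_extend 𝓘(ℝ, E) E (Y p)
  have hAext := MDifferentiableAt.clm_bundle_apply hA hext
  have h5 : ∀ w, mvfderiv 𝓘(ℝ, E) (fun z ↦ (t (TotalSpace.mk' E z
      (A z (FiberBundle.extend E (Y p) z)))).2) (f p) w
      = mvfderiv 𝓘(ℝ, E) Ahat (f p) w (t (TotalSpace.mk' E (f p) (Y p))).2 := by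
    intro w
    have h2 : (fun z ↦ (t (TotalSpace.mk' E z (A z (FiberBundle.extend E (Y p) z)))).2)
        =ᶠ[𝓝 (f p)] fun z ↦ Ahat z (t (TotalSpace.mk' E (f p) (Y p))).2 := by
      filter_upwards [hnhds] with z hz
      rw [hAapp z hz, trivializationAt_extend_snd hz]
    have h3 := mvfderiv_clm_apply (Φ := Ahat) (p := f p) hAhat
      (c := fun _ ↦ (t (TotalSpace.mk' E (f p) (Y p))).2) mdifferentiableAt_const w
    rw [mvfderiv_const, zero_apply, map_zero, add_zero] at h3
    refine Eq.trans ?_ h3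
    exact congrArg (fun L : E →L[ℝ] E ↦ L w) h2.mfderiv_eq
  have h6 := covAlong_id cov hAext (mfderiv 𝓘(ℝ, F) 𝓘(ℝ, E) f p v)
  simp only [covEnd]
  rw [← h6]
  simp only [covAlong]
  rw [h5, h1, FiberBundle.extend_apply_self, map_add, map_add, hAsymm]
  have : mfderiv 𝓘(ℝ, E) 𝓘(ℝ, E) (fun z : N ↦ z) (f p) = ContinuousLinearMap.id ℝ _ := mfderiv_id
  rw [this]
  simp only [ContinuousLinearMap.id_apply]
  abel

/-- Leibniz rule `∇_w (A Y) = (∇_w A) Y + A (∇_w Y)` for a vector field `Y`. -/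
theorem cov_endo_apply [FiniteDimensional ℝ E]
    (cov : CovariantDerivative 𝓘(ℝ, E) E (TangentSpace 𝓘(ℝ, E) : N → Type _))
    {A : Π x : N, TangentSpace 𝓘(ℝ, E) x →L[ℝ] TangentSpace 𝓘(ℝ, E) x} {x : N}
    (hA : MDifferentiableEndAt A x) {Y : Π x : N, TangentSpace 𝓘(ℝ, E) x}
    (hY : MDifferentiableAt 𝓘(ℝ, E) 𝓘(ℝ, E).tangent
      (fun y ↦ (TotalSpace.mk' E y (Y y) : TangentBundle 𝓘(ℝ, E) N)) x)
    (w : TangentSpace 𝓘(ℝ, E) x) :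
    cov (fun z ↦ A z (Y z)) x w = covEnd cov A x w (Y x) + A x (cov Y x w) := by
  have h := covAlong_endo_apply (f := fun z : N ↦ z) cov hA mdifferentiableAt_id hY w
  rw [covAlong_id cov hY, covAlong_id cov (MDifferentiableAt.clm_bundle_apply hA hY)] at h
  rw [h]
  have : mfderiv 𝓘(ℝ, E) 𝓘(ℝ, E) (fun z : N ↦ z) x = ContinuousLinearMap.id ℝ _ := mfderiv_id
  rw [this]
  rfl

end

/-! ### Normal contact pairs -/

section

variable {E : Type*} [NormedAddCommGroup E] [NormedSpace ℝ E]
  {N : Type*} [TopologicalSpace N] [ChartedSpace E N] [IsManifold 𝓘(ℝ, E) ∞ N]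

/-- Near `x`, the vector field `X` is smooth and annihilated by `α` and `β`. -/
def IsSmoothKernelFieldNear (α β : Π x : N, TangentSpace 𝓘(ℝ, E) x →L[ℝ] ℝ)
    (X : Π x : N, TangentSpace 𝓘(ℝ, E) x) (x : N) : Prop :=
  ∀ᶠ y in 𝓝 x, SmoothFieldAt X y ∧ α y (X y) = 0 ∧ β y (X y) = 0

/-- What `(u, v, σ, G, H)` and `(v, u, -σ, H, G)` have in common on a normal complex contact metric
manifold. The one-forms `α`, `β` cut out the horizontal subspaces, and `dα`, `dβ` are given by the
skew endomorphisms `A`, `B` up to wedge products with `σ`. The last field is the horizontal part of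
normality: it prescribes the Nijenhuis tensor of `A` on horizontal fields, modulo vectors
orthogonal to all horizontal ones. -/
structure IsNormalContactPair (g : SemiRiemannianMetric E N) (O : Set N)
    (α β σ : Π x : N, TangentSpace 𝓘(ℝ, E) x →L[ℝ] ℝ)
    (A B : Π x : N, TangentSpace 𝓘(ℝ, E) x →L[ℝ] TangentSpace 𝓘(ℝ, E) x) : Prop where
  isOpen : IsOpen O
  mdifferentiable : ∀ x ∈ O, MDifferentiableEndAt A x
  skew : ∀ x ∈ O, ∀ X Y, g.val x (A x X) Y = -g.val x X (A x Y)
  skew_right : ∀ x ∈ O, ∀ X Y, g.val x (B x X) Y = -g.val x X (B x Y)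
  map_ker : ∀ x ∈ O, ∀ X, α x (A x X) = 0 ∧ β x (A x X) = 0
  sq : ∀ x ∈ O, ∀ X, α x X = 0 → β x X = 0 → A x (A x X) = -X
  d_left : ∀ x ∈ O, ∀ X Y : Π y : N, TangentSpace 𝓘(ℝ, E) y, SmoothFieldAt X x →
    SmoothFieldAt Y x →
    oneFormD α X Y x = g.val x (X x) (A x (Y x)) + covectorWedge (σ x) (β x) (X x) (Y x)
  d_right : ∀ x ∈ O, ∀ X Y : Π y : N, TangentSpace 𝓘(ℝ, E) y, SmoothFieldAt X x →
    SmoothFieldAt Y x →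
    oneFormD β X Y x = g.val x (X x) (B x (Y x)) - covectorWedge (σ x) (α x) (X x) (Y x)
  /-- horizontal vectors extend to horizontal vector fields -/
  exists_field : ∀ x ∈ O, ∀ w, α x w = 0 → β x w = 0 →
    ∃ X, IsSmoothKernelFieldNear α β X x ∧ X x = w
  nijenhuis_eq : ∀ x ∈ O, ∀ X Y : Π y : N, TangentSpace 𝓘(ℝ, E) y,
    IsSmoothKernelFieldNear α β X x → IsSmoothKernelFieldNear α β Y x →
    ∀ Z, α x Z = 0 → β x Z = 0 →
    g.val x (nijenhuis A X Y x) Z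
      = g.val x (σ x (A x (X x)) • B x (Y x) - σ x (A x (Y x)) • B x (X x)
        + σ x (Y x) • A x (B x (X x)) - σ x (X x) • A x (B x (Y x))) Z

theorem oneFormD_of_eventually_zero {N : Type*} [TopologicalSpace N] [ChartedSpace E N]
    {α : Π x : N, TangentSpace 𝓘(ℝ, E) x →L[ℝ] ℝ}
    {X Y : Π x : N, TangentSpace 𝓘(ℝ, E) x} {x : N}
    (hX : ∀ᶠ y in 𝓝 x, α y (X y) = 0) :
    oneFormD α X Y x = (1 / 2 : ℝ) * (mvfderiv 𝓘(ℝ, E) (fun y ↦ α y (Y y)) x (X x)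
      - α x (VectorField.mlieBracket 𝓘(ℝ, E) X Y x)) := by
  have h : mvfderiv 𝓘(ℝ, E) (fun y ↦ α y (X y)) x (Y x) = 0 := by
    have h1 : (fun y ↦ α y (X y)) =ᶠ[𝓝 x] fun _ ↦ (0 : ℝ) := hX
    refine Eq.trans ?_ (congrArg (fun L : E →L[ℝ] ℝ ↦ L (Y x))
      (mvfderiv_const (I := 𝓘(ℝ, E)) (x := x) (0 : ℝ)))
    exact congrArg (fun L : E →L[ℝ] ℝ ↦ L (Y x)) h1.mfderiv_eq
  rw [oneFormD, h, sub_zero]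

theorem oneFormD_of_eventually_zero₂ {N : Type*} [TopologicalSpace N] [ChartedSpace E N]
    {α : Π x : N, TangentSpace 𝓘(ℝ, E) x →L[ℝ] ℝ}
    {X Y : Π x : N, TangentSpace 𝓘(ℝ, E) x} {x : N}
    (hX : ∀ᶠ y in 𝓝 x, α y (X y) = 0) (hY : ∀ᶠ y in 𝓝 x, α y (Y y) = 0) :
    oneFormD α X Y x = -(1 / 2 : ℝ) * α x (VectorField.mlieBracket 𝓘(ℝ, E) X Y x) := by
  have h : mvfderiv 𝓘(ℝ, E) (fun y ↦ α y (Y y)) x (X x) = 0 := by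
    have h1 : (fun y ↦ α y (Y y)) =ᶠ[𝓝 x] fun _ ↦ (0 : ℝ) := hY
    refine Eq.trans ?_ (congrArg (fun L : E →L[ℝ] ℝ ↦ L (X x))
      (mvfderiv_const (I := 𝓘(ℝ, E)) (x := x) (0 : ℝ)))
    exact congrArg (fun L : E →L[ℝ] ℝ ↦ L (X x)) h1.mfderiv_eq
  rw [oneFormD_of_eventually_zero hX, h]
  ring

variable {g : SemiRiemannianMetric E N}
  {cov : CovariantDerivative 𝓘(ℝ, E) E (TangentSpace 𝓘(ℝ, E) : N → Type _)}

theorem SmoothFieldAt.mdifferentiableAt {X : Π x : N, TangentSpace 𝓘(ℝ, E) x} {x : N}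
    (hX : SmoothFieldAt X x) : MDifferentiableAt 𝓘(ℝ, E) 𝓘(ℝ, E).tangent
      (fun y ↦ (TotalSpace.mk' E y (X y) : TangentBundle 𝓘(ℝ, E) N)) x :=
  ContMDiffAt.mdifferentiableAt hX (by simp)

theorem SmoothFieldAt.mlieBracket [CompleteSpace E] {X Y : Π x : N, TangentSpace 𝓘(ℝ, E) x} {x : N}
    (hX : SmoothFieldAt X x) (hY : SmoothFieldAt Y x) :
    SmoothFieldAt (VectorField.mlieBracket 𝓘(ℝ, E) X Y) x := by
  have : IsManifold 𝓘(ℝ, E) ((⊤ : ℕ∞) + 1) N := by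
    change IsManifold 𝓘(ℝ, E) ∞ N
    infer_instance
  have : IsManifold 𝓘(ℝ, E) (minSmoothness ℝ 2) N := by
    rw [minSmoothness_of_isRCLikeNormedField]
    infer_instance
  exact ContMDiffAt.mlieBracket_vectorField (m := ⊤) (n := ⊤) hX hY (by simp)

theorem SemiRiemannianMetric.mdifferentiableAt_val {Y Z : Π x : N, TangentSpace 𝓘(ℝ, E) x} {x : N}
    (hY : MDifferentiableAt 𝓘(ℝ, E) 𝓘(ℝ, E).tangent
      (fun y ↦ (TotalSpace.mk' E y (Y y) : TangentBundle 𝓘(ℝ, E) N)) x)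
    (hZ : MDifferentiableAt 𝓘(ℝ, E) 𝓘(ℝ, E).tangent
      (fun y ↦ (TotalSpace.mk' E y (Z y) : TangentBundle 𝓘(ℝ, E) N)) x) :
    MDifferentiableAt 𝓘(ℝ, E) 𝓘(ℝ, ℝ) (fun y ↦ g.val y (Y y) (Z y)) x := by
  have : MDifferentiableAt 𝓘(ℝ, E) (𝓘(ℝ, E).prod 𝓘(ℝ))
      (fun y ↦ TotalSpace.mk' ℝ (E := Bundle.Trivial N ℝ) y (g.val y (Y y) (Z y))) x :=
    MDifferentiableAt.clm_bundle_apply₂ (F₁ := E) (F₂ := E)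
      (g.contMDiff.contMDiffAt.mdifferentiableAt (by simp)) hY hZ
  exact ((mdifferentiableAt_totalSpace _ _).1 this).2

theorem contMDiffAt_covector_apply {α : Π x : N, TangentSpace 𝓘(ℝ, E) x →L[ℝ] ℝ} {x : N}
    (hα : ContMDiffAt 𝓘(ℝ, E) (𝓘(ℝ, E).prod 𝓘(ℝ, E →L[ℝ] ℝ)) ∞
      (fun x ↦ TotalSpace.mk' (E →L[ℝ] ℝ)
        (E := fun x : N ↦ TangentSpace 𝓘(ℝ, E) x →L[ℝ] ℝ) x (α x)) x)
    {X : Π x : N, TangentSpace 𝓘(ℝ, E) x} (hX : SmoothFieldAt X x) :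
    ContMDiffAt 𝓘(ℝ, E) 𝓘(ℝ, ℝ) ∞ (fun y ↦ α y (X y)) x := by
  have : ContMDiffAt 𝓘(ℝ, E) (𝓘(ℝ, E).prod 𝓘(ℝ)) ∞
      (fun y ↦ TotalSpace.mk' ℝ (E := Bundle.Trivial N ℝ) y (α y (X y))) x :=
    ContMDiffAt.clm_bundle_apply (F₁ := E) (F₂ := ℝ) (E₂ := Bundle.Trivial N ℝ) hα hX
  exact (contMDiffAt_totalSpace.1 this).2

/-- The Nijenhuis tensor in terms of a torsion-free connection:
`[A, A](X, Y) = (∇_{AX} A) Y - (∇_{AY} A) X + A (∇_Y A) X - A (∇_X A) Y`. -/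
theorem nijenhuis_eq_covEnd [FiniteDimensional ℝ E] (hcov : g.IsLeviCivita cov)
    {A : Π x : N, TangentSpace 𝓘(ℝ, E) x →L[ℝ] TangentSpace 𝓘(ℝ, E) x} {x : N}
    (hA : MDifferentiableEndAt A x) {X Y : Π x : N, TangentSpace 𝓘(ℝ, E) x}
    (hX : SmoothFieldAt X x) (hY : SmoothFieldAt Y x) :
    nijenhuis A X Y x = covEnd cov A x (A x (X x)) (Y x) - covEnd cov A x (A x (Y x)) (X x)
      + A x (covEnd cov A x (Y x) (X x)) - A x (covEnd cov A x (X x) (Y x)) := by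
  have hX1 := hX.mdifferentiableAt
  have hY1 := hY.mdifferentiableAt
  have hAX := MDifferentiableAt.clm_bundle_apply hA hX1
  have hAY := MDifferentiableAt.clm_bundle_apply hA hY1
  simp only [nijenhuis]
  rw [← hcov.torsion_free _ _ x hX1 hY1, ← hcov.torsion_free _ _ x hAX hAY,
    ← hcov.torsion_free _ _ x hAX hY1, ← hcov.torsion_free _ _ x hX1 hAY]
  simp only [cov_endo_apply cov hA hX1, cov_endo_apply cov hA hY1, map_sub, map_add]
  abel

theorem mvfderiv_metric_endo [FiniteDimensional ℝ E] (hcov : g.IsLeviCivita cov)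
    {A : Π x : N, TangentSpace 𝓘(ℝ, E) x →L[ℝ] TangentSpace 𝓘(ℝ, E) x} {x : N}
    (hA : MDifferentiableEndAt A x) {Y Z : Π x : N, TangentSpace 𝓘(ℝ, E) x}
    (hY : SmoothFieldAt Y x) (hZ : SmoothFieldAt Z x) (w : TangentSpace 𝓘(ℝ, E) x) :
    mvfderiv 𝓘(ℝ, E) (fun y ↦ g.val y (Y y) (A y (Z y))) x w
      = g.val x (cov Y x w) (A x (Z x))
        + (g.val x (Y x) (covEnd cov A x w (Z x)) + g.val x (Y x) (A x (cov Z x w))) := by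
  rw [hcov.metric Y (fun y ↦ A y (Z y)) x w hY.mdifferentiableAt
    (MDifferentiableAt.clm_bundle_apply hA hZ.mdifferentiableAt),
    cov_endo_apply cov hA hZ.mdifferentiableAt, map_add]

theorem smoothFieldAt_extend {x : N} (w : TangentSpace 𝓘(ℝ, E) x) :
    SmoothFieldAt (FiberBundle.extend E w : Π y : N, TangentSpace 𝓘(ℝ, E) y) x :=
  FiberBundle.contMDiffAt_extend 𝓘(ℝ, E) E w

/-- The covariant derivative of a skew field of endomorphisms is skew. -/
theorem covEnd_skew [FiniteDimensional ℝ E] (hcov : g.IsLeviCivita cov)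
    {A : Π x : N, TangentSpace 𝓘(ℝ, E) x →L[ℝ] TangentSpace 𝓘(ℝ, E) x} {x : N}
    (hA : MDifferentiableEndAt A x)
    (hskew : ∀ᶠ y in 𝓝 x, ∀ X Y, g.val y (A y X) Y = -g.val y X (A y Y))
    (w Y Z : TangentSpace 𝓘(ℝ, E) x) :
    g.val x (covEnd cov A x w Y) Z = -g.val x (covEnd cov A x w Z) Y := by
  have hY := smoothFieldAt_extend Y
  have hZ := smoothFieldAt_extend Z
  have h1 := mvfderiv_metric_endo hcov hA hY hZ w
  have h2 := mvfderiv_metric_endo hcov hA hZ hY w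
  have h3 : (fun y ↦ g.val y (FiberBundle.extend E Y y) (A y (FiberBundle.extend E Z y)))
      =ᶠ[𝓝 x] -(fun y ↦ g.val y (FiberBundle.extend E Z y) (A y (FiberBundle.extend E Y y))) := by
    filter_upwards [hskew] with y hy
    rw [g.symm, hy]
    rfl
  have h4 : mvfderiv 𝓘(ℝ, E)
      (fun y ↦ g.val y (FiberBundle.extend E Y y) (A y (FiberBundle.extend E Z y))) x w
      = -mvfderiv 𝓘(ℝ, E)
      (fun y ↦ g.val y (FiberBundle.extend E Z y) (A y (FiberBundle.extend E Y y))) x w := by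
    refine Eq.trans ?_ (congrArg (fun L : E →L[ℝ] ℝ ↦ L w) (mvfderiv_neg (I := 𝓘(ℝ, E))))
    exact congrArg (fun L : E →L[ℝ] ℝ ↦ L w) h3.mfderiv_eq
  rw [h1, h2] at h4
  simp only [FiberBundle.extend_apply_self] at h4
  have hs := hskew.self_of_nhds
  rw [g.symm x (cov _ x w) (A x Z), g.symm x (cov _ x w) (A x Y), hs, hs,
    g.symm x Y (covEnd _ _ _ _ _), g.symm x Z (covEnd _ _ _ _ _)] at h4
  linarith

namespace IsNormalContactPair

variable {O : Set N} {α β σ : Π x : N, TangentSpace 𝓘(ℝ, E) x →L[ℝ] ℝ}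
  {A B : Π x : N, TangentSpace 𝓘(ℝ, E) x →L[ℝ] TangentSpace 𝓘(ℝ, E) x}

/-- Expansion of `α [X, [Y, Z]]` for horizontal fields. As `dα(Y, Z) = g(Y, A Z)` and
`dα(Y, Z) = -α [Y, Z] / 2`, the expression for `dα(X, [Y, Z])` contains the derivative of
`g(Y, A Z)` along `X`, hence `g(Y, (∇_X A) Z)`; the term with `σ` comes from `β [Y, Z]`, which is
given by `dβ`. -/
theorem metric_covEnd_eq [FiniteDimensional ℝ E] (hcov : g.IsLeviCivita cov)
    (h : IsNormalContactPair g O α β σ A B) {x : N} (hx : x ∈ O)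
    {X Y Z : Π y : N, TangentSpace 𝓘(ℝ, E) y} (hX : IsSmoothKernelFieldNear α β X x)
    (hY : IsSmoothKernelFieldNear α β Y x) (hZ : IsSmoothKernelFieldNear α β Z x) :
    g.val x (Y x) (covEnd cov A x (X x) (Z x))
      = σ x (X x) * g.val x (Y x) (B x (Z x))
        - (1 / 2) * α x (VectorField.mlieBracket 𝓘(ℝ, E) X
            (VectorField.mlieBracket 𝓘(ℝ, E) Y Z) x)
        - g.val x (X x) (A x (cov Z x (Y x))) + g.val x (X x) (A x (cov Y x (Z x)))
        + g.val x (Z x) (A x (cov Y x (X x))) - g.val x (Y x) (A x (cov Z x (X x))) := by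
  have hX0 := hX.self_of_nhds
  have hY0 := hY.self_of_nhds
  have hZ0 := hZ.self_of_nhds
  have hbr := hY0.1.mlieBracket hZ0.1
  have hO : ∀ᶠ y in 𝓝 x, y ∈ O := h.isOpen.mem_nhds hx
  have h1 : (fun y ↦ α y (VectorField.mlieBracket 𝓘(ℝ, E) Y Z y))
      =ᶠ[𝓝 x] (-2 : ℝ) • fun y ↦ g.val y (Y y) (A y (Z y)) := by
    filter_upwards [hO, hY.eventually_nhds, hZ.eventually_nhds] with y hy hYy hZy
    have h2 := h.d_left y hy Y Z hYy.self_of_nhds.1 hZy.self_of_nhds.1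
    rw [oneFormD_of_eventually_zero₂ (hYy.mono fun _ h ↦ h.2.1) (hZy.mono fun _ h ↦ h.2.1),
      covectorWedge, hYy.self_of_nhds.2.2, hZy.self_of_nhds.2.2] at h2
    simp only [Pi.smul_apply, smul_eq_mul]
    linarith
  have h2 := mvfderiv_metric_endo hcov (h.mdifferentiable x hx) hY0.1 hZ0.1 (X x)
  have h3 : mvfderiv 𝓘(ℝ, E) (fun y ↦ α y (VectorField.mlieBracket 𝓘(ℝ, E) Y Z y)) x (X x)
      = -2 * mvfderiv 𝓘(ℝ, E) (fun y ↦ g.val y (Y y) (A y (Z y))) x (X x) := by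
    have hd := SemiRiemannianMetric.mdifferentiableAt_val (g := g) hY0.1.mdifferentiableAt
      (MDifferentiableAt.clm_bundle_apply (h.mdifferentiable x hx) hZ0.1.mdifferentiableAt)
    refine Eq.trans ?_ (congrArg (fun L : E →L[ℝ] ℝ ↦ L (X x))
      (const_smul_mfderiv (I := 𝓘(ℝ, E)) hd (-2 : ℝ)))
    exact congrArg (fun L : E →L[ℝ] ℝ ↦ L (X x)) h1.mfderiv_eq
  have h4 := h.d_left x hx X _ hX0.1 hbr
  rw [oneFormD_of_eventually_zero (hX.mono fun _ h ↦ h.2.1), covectorWedge, hX0.2.2] at h4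
  have h5 := h.d_right x hx Y Z hY0.1 hZ0.1
  rw [oneFormD_of_eventually_zero₂ (hY.mono fun _ h ↦ h.2.2) (hZ.mono fun _ h ↦ h.2.2),
    covectorWedge, hY0.2.1, hZ0.2.1] at h5
  have htor := hcov.torsion_free Y Z x hY0.1.mdifferentiableAt hZ0.1.mdifferentiableAt
  have h6 : g.val x (X x) (A x (VectorField.mlieBracket 𝓘(ℝ, E) Y Z x))
      = g.val x (X x) (A x (cov Z x (Y x))) - g.val x (X x) (A x (cov Y x (Z x))) := by
    rw [← htor, map_sub, map_sub]
  have h7 : g.val x (cov Y x (X x)) (A x (Z x)) = -g.val x (Z x) (A x (cov Y x (X x))) := by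
    rw [g.symm, h.skew x hx]
  rw [h2] at h3
  linear_combination (1 / 2) * h3 - h4 - h6 - h7 + σ x (X x) * h5

/-- The content of `d²α = 0` on horizontal vectors: summing `metric_covEnd_eq` cyclically, the
iterated brackets cancel by the Jacobi identity and the terms with `∇_X Y` cancel in pairs. -/
theorem cyclic_sum [FiniteDimensional ℝ E] (hcov : g.IsLeviCivita cov)
    (h : IsNormalContactPair g O α β σ A B) {x : N} (hx : x ∈ O)
    {X Y Z : TangentSpace 𝓘(ℝ, E) x} (hX : α x X = 0 ∧ β x X = 0) (hY : α x Y = 0 ∧ β x Y = 0)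
    (hZ : α x Z = 0 ∧ β x Z = 0) :
    g.val x Y (covEnd cov A x X Z) + g.val x Z (covEnd cov A x Y X)
        + g.val x X (covEnd cov A x Z Y)
      = σ x X * g.val x Y (B x Z) + σ x Y * g.val x Z (B x X) + σ x Z * g.val x X (B x Y) := by
  obtain ⟨hX1, hX2⟩ := hX
  obtain ⟨hY1, hY2⟩ := hY
  obtain ⟨hZ1, hZ2⟩ := hZ
  obtain ⟨X, hX, rfl⟩ := h.exists_field x hx X hX1 hX2
  obtain ⟨Y, hY, rfl⟩ := h.exists_field x hx Y hY1 hY2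
  obtain ⟨Z, hZ, rfl⟩ := h.exists_field x hx Z hZ1 hZ2
  have h1 := h.metric_covEnd_eq hcov hx hX hY hZ
  have h2 := h.metric_covEnd_eq hcov hx hY hZ hX
  have h3 := h.metric_covEnd_eq hcov hx hZ hX hY
  have hX0 := hX.self_of_nhds.1
  have hY0 := hY.self_of_nhds.1
  have hZ0 := hZ.self_of_nhds.1
  have : IsManifold 𝓘(ℝ, E) (minSmoothness ℝ 3) N := by
    rw [minSmoothness_of_isRCLikeNormedField]
    infer_instance
  have h2le : minSmoothness ℝ 2 ≤ ∞ := by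
    rw [minSmoothness_of_isRCLikeNormedField]
    exact WithTop.coe_le_coe.2 le_top
  have hJ := VectorField.leibniz_identity_mlieBracket_apply (hX0.of_le h2le) (hY0.of_le h2le)
    (hZ0.of_le h2le)
  have hs : VectorField.mlieBracket 𝓘(ℝ, E) Y (VectorField.mlieBracket 𝓘(ℝ, E) Z X) x
      = -VectorField.mlieBracket 𝓘(ℝ, E) Y (VectorField.mlieBracket 𝓘(ℝ, E) X Z) x := by
    have h4 := VectorField.mlieBracket_const_smul_right (I := 𝓘(ℝ, E)) (V := Y) (c := (-1 : ℝ))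
      (hX0.mlieBracket hZ0).mdifferentiableAt
    rw [neg_one_smul, neg_one_smul, ← VectorField.mlieBracket_swap] at h4
    exact h4
  have hsum : α x (VectorField.mlieBracket 𝓘(ℝ, E) X (VectorField.mlieBracket 𝓘(ℝ, E) Y Z) x)
      + α x (VectorField.mlieBracket 𝓘(ℝ, E) Y (VectorField.mlieBracket 𝓘(ℝ, E) Z X) x)
      + α x (VectorField.mlieBracket 𝓘(ℝ, E) Z (VectorField.mlieBracket 𝓘(ℝ, E) X Y) x) = 0 := by
    rw [hs, hJ, VectorField.mlieBracket_swap_apply (V := VectorField.mlieBracket 𝓘(ℝ, E) X Y),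
      map_add, map_neg, map_neg]
    ring
  rw [h1, h2, h3]
  linear_combination -(1 / 2) * hsum

/-- The covariant derivative of `A` is `σ ⊗ B` on horizontal vectors. Skewness, the cyclic sum and
the Nijenhuis tensor determine the horizontal part of `∇A` completely. -/
theorem metric_covEnd [FiniteDimensional ℝ E] (hcov : g.IsLeviCivita cov)
    (h : IsNormalContactPair g O α β σ A B) {x : N} (hx : x ∈ O)
    {X Y Z : TangentSpace 𝓘(ℝ, E) x} (hX : α x X = 0 ∧ β x X = 0) (hY : α x Y = 0 ∧ β x Y = 0)
    (hZ : α x Z = 0 ∧ β x Z = 0) :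
    g.val x (covEnd cov A x X Y) Z = σ x X * g.val x (B x Y) Z := by
  -- the defect `D` is to vanish on horizontal vectors, which are those satisfying `K`
  let D (X Y Z : TangentSpace 𝓘(ℝ, E) x) : ℝ :=
    g.val x (covEnd cov A x X Y) Z - σ x X * g.val x (B x Y) Z
  let K (X : TangentSpace 𝓘(ℝ, E) x) : Prop := α x X = 0 ∧ β x X = 0
  have hO : ∀ᶠ y in 𝓝 x, y ∈ O := h.isOpen.mem_nhds hx
  have hA := h.mdifferentiable x hx
  have hskew : ∀ X Y Z, D X Y Z = -D X Z Y := by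
    intro X Y Z
    have h1 := covEnd_skew hcov hA (hO.mono fun y hy ↦ h.skew y hy) X Y Z
    have h2 := h.skew_right x hx Y Z
    simp only [D]
    rw [h1, h2, g.symm x Y]
    ring
  have hcyc : ∀ X Y Z, K X → K Y → K Z → D X Y Z + D Y Z X + D Z X Y = 0 := by
    intro X Y Z hX hY hZ
    have h1 := h.cyclic_sum hcov hx hX hZ hY
    simp only [D]
    rw [g.symm x (covEnd _ _ _ _ _), g.symm x (covEnd _ _ _ _ _), g.symm x (covEnd _ _ _ _ _),
      g.symm x (B _ _), g.symm x (B _ _), g.symm x (B _ _)]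
    linear_combination h1
  have hN : ∀ X Y Z, K X → K Y → K Z →
      D (A x X) Y Z - D (A x Y) X Z - D Y X (A x Z) + D X Y (A x Z) = 0 := by
    intro X Y Z hX hY hZ
    obtain ⟨X, hX', rfl⟩ := h.exists_field x hx X hX.1 hX.2
    obtain ⟨Y, hY', rfl⟩ := h.exists_field x hx Y hY.1 hY.2
    have h1 := h.nijenhuis_eq x hx X Y hX' hY' Z hZ.1 hZ.2
    rw [nijenhuis_eq_covEnd hcov hA hX'.self_of_nhds.1 hY'.self_of_nhds.1] at h1
    simp only [map_sub, map_add, map_smul, sub_apply, add_apply, smul_apply, smul_eq_mul,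
      h.skew x hx _ Z] at h1
    simp only [D]
    linear_combination h1
  -- `p + q = r`, where `p = D (A X) Y Z`, and `q`, `r` arise from `p` by permuting `X, Y, Z`
  -- cyclically
  have hpqr : ∀ X Y Z, K X → K Y → K Z → D (A x X) Y Z + D (A x Y) Z X - D (A x Z) X Y = 0 := by
    intro X Y Z hX hY hZ
    have h1 := hN X Y Z hX hY hZ
    have h2 := hcyc X Y (A x Z) hX hY (h.map_ker x hx Z)
    have h3 := hskew (A x Y) X Z
    have h4 := hskew Y X (A x Z)
    linear_combination h1 - h2 + h3 + h4
  have hzero : ∀ X Y Z, K X → K Y → K Z → D (A x X) Y Z = 0 := by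
    -- besides `p + q = r` also `r + p = q`, so that `2 p = 0`
    intro X Y Z hX hY hZ
    linear_combination (1 / 2) * (hpqr X Y Z hX hY hZ) + (1 / 2) * (hpqr Z X Y hZ hX hY)
  -- `A` maps the horizontal vectors onto themselves
  have hAA : A x (-A x X) = X := by rw [map_neg, h.sq x hx X hX.1 hX.2, neg_neg]
  have hK : K (-A x X) := by
    have := h.map_ker x hx X
    exact ⟨by rw [map_neg, this.1, neg_zero], by rw [map_neg, this.2, neg_zero]⟩
  have := hzero (-A x X) Y Z hK hY hZ
  rw [hAA] at this
  exact sub_eq_zero.1 this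

end IsNormalContactPair

end

/-! ### Horizontal fields and the normality tensors -/

section

variable {E : Type*} [NormedAddCommGroup E] [NormedSpace ℂ E]
  {N : Type*} [TopologicalSpace N] [ChartedSpace E N] [IsManifold 𝓘(ℂ, E) ω N]

theorem complexJ_complexJ {N : Type*} [TopologicalSpace N] [ChartedSpace E N] (x : N)
    (X : TangentSpace 𝓘(ℝ, E) x) : complexJ x (complexJ x X) = -X := by
  have h : ∀ a : E, Complex.I • Complex.I • a = -a := fun a ↦ by
    rw [smul_smul, Complex.I_mul_I, neg_one_smul]
  exact h X

/-- The coordinate changes of the tangent bundle of a complex manifold are complex linear. -/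
theorem tangentCoordChange_complexJ {x y z : N} (hx : z ∈ (chartAt E x).source)
    (hy : z ∈ (chartAt E y).source) (v : E) :
    tangentCoordChange 𝓘(ℝ, E) x y z (Complex.I • v)
      = Complex.I • tangentCoordChange 𝓘(ℝ, E) x y z v := by
  have : IsManifold 𝓘(ℂ, E) 1 N := IsManifold.of_le (n := ω) le_top
  have hC := hasFDerivWithinAt_tangentCoordChange (I := 𝓘(ℂ, E)) (x := x) (y := y) (z := z)
    (by simp [hx, hy])
  have hR := hasFDerivWithinAt_tangentCoordChange (I := 𝓘(ℝ, E)) (x := x) (y := y) (z := z)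
    (by simp [hx, hy])
  have hC' := hC.restrictScalars ℝ
  rw [modelWithCornersSelf_coe, range_id, hasFDerivWithinAt_univ] at hC' hR
  have h : tangentCoordChange 𝓘(ℝ, E) x y z
      = (tangentCoordChange 𝓘(ℂ, E) x y z).restrictScalars ℝ := hR.unique hC'
  rw [h]
  exact map_smul (tangentCoordChange 𝓘(ℂ, E) x y z) Complex.I v

/-- The complex structure `J` is smooth, since it is constant in every holomorphic chart. -/
theorem contMDiffAt_complexJ (x : N) :
    ContMDiffAt 𝓘(ℝ, E) (𝓘(ℝ, E).prod 𝓘(ℝ, E →L[ℝ] E)) ∞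
      (fun x ↦ TotalSpace.mk' (E →L[ℝ] E)
        (E := fun x : N ↦ TangentSpace 𝓘(ℝ, E) x →L[ℝ] TangentSpace 𝓘(ℝ, E) x) x
        (complexJ x)) x := by
  rw [contMDiffAt_hom_bundle]
  refine ⟨contMDiffAt_id, ?_⟩
  let c : E →L[ℝ] E := complexJ x
  refine (contMDiffAt_const (c := c)).congr_of_eventuallyEq ?_
  have hsrc : ∀ᶠ y in 𝓝 x, y ∈ (chartAt E x).source :=
    (chartAt E x).open_source.mem_nhds (mem_chart_source E x)
  filter_upwards [hsrc] with y hy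
  ext v
  let t := trivializationAt E (TangentSpace 𝓘(ℝ, E) : N → Type _) x
  have hb : y ∈ t.baseSet := hy
  change t.continuousLinearMapAt ℝ y (complexJ y (t.symmL ℝ y v)) = (Complex.I • v : E)
  have h1 := t.continuousLinearMapAt_symmL (R := ℝ) hb v
  have h2 := TangentBundle.continuousLinearMapAt_trivializationAt_eq_core (I := 𝓘(ℝ, E)) hy
  have h3 := tangentCoordChange_complexJ (mem_chart_source E y) hy (t.symmL ℝ y v)
  have h4 : ∀ w : E, t.continuousLinearMapAt ℝ y w = tangentCoordChange 𝓘(ℝ, E) y x y w :=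
    fun w ↦ congrArg (fun L : E →L[ℝ] E ↦ L w) h2
  refine (h4 _).trans (h3.trans ?_)
  exact congrArg (fun w : E ↦ Complex.I • w) ((h4 _).symm.trans h1)

theorem mdifferentiableEndAt_complexJ (x : N) :
    MDifferentiableEndAt (complexJ (E := E) (M := N)) x :=
  (contMDiffAt_complexJ x).mdifferentiableAt (by simp)

theorem MDifferentiableEndAt.comp
    {A B : Π x : N, TangentSpace 𝓘(ℝ, E) x →L[ℝ] TangentSpace 𝓘(ℝ, E) x} {x : N}
    (hA : MDifferentiableEndAt A x) (hB : MDifferentiableEndAt B x) :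
    MDifferentiableEndAt (fun y ↦ (A y).comp (B y)) x := by
  have hA' := (mdifferentiableAt_hom_bundle _).1 hA
  have hB' := (mdifferentiableAt_hom_bundle _).1 hB
  refine (mdifferentiableAt_hom_bundle _).2 ⟨mdifferentiableAt_id, ?_⟩
  refine (hA'.2.clm_comp hB'.2).congr_of_eventuallyEq ?_
  let t := trivializationAt E (TangentSpace 𝓘(ℝ, E) : N → Type _) x
  have hb : x ∈ t.baseSet := FiberBundle.mem_baseSet_trivializationAt' x
  filter_upwards [t.open_baseSet.mem_nhds hb] with y hy
  ext v
  exact congrArg (fun w ↦ t.continuousLinearMapAt ℝ y (A y w))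
    (t.symmL_continuousLinearMapAt (R := ℝ) hy (B y (t.symmL ℝ y v))).symm

namespace ComplexContactMetricStructure

variable {ι : Type*} {n : ℕ} (C : ComplexContactMetricStructure ι n E N) {i : ι} {x : N}

theorem g_J (x : N) (X Y) : C.g.val x (complexJ x X) Y = -C.g.val x X (complexJ x Y) := by
  have h := C.hermitian x X (complexJ x Y)
  rw [complexJ_complexJ, map_neg] at h
  linarith

theorem v_apply (X) : C.v i x X = C.u i x (complexJ x X) := rfl

theorem H_apply (X) : C.H i x X = C.G i x (complexJ x X) := rfl

theorem V_eq : C.V i x = -complexJ x (C.U i x) := rfl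

theorem g_V (hx : x ∈ C.O i) (X) : C.g.val x (C.V i x) X = C.v i x X := by
  rw [V_eq, map_neg, neg_apply, g_J, neg_neg, C.g_U i x hx, v_apply]

theorem v_J (X) : C.v i x (complexJ x X) = -C.u i x X := by
  rw [v_apply, complexJ_complexJ, map_neg]

theorem v_U (hx : x ∈ C.O i) : C.v i x (C.U i x) = 0 := by
  have h := C.g_J x (C.U i x) (C.U i x)
  rw [C.g.symm, C.g_U i x hx, ← v_apply] at h
  linarith

theorem u_V (hx : x ∈ C.O i) : C.u i x (C.V i x) = 0 := by
  rw [V_eq, map_neg, ← v_apply, C.v_U hx, neg_zero]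

theorem v_V (hx : x ∈ C.O i) : C.v i x (C.V i x) = 1 := by
  rw [V_eq, map_neg, v_J, neg_neg, C.u_U i x hx]

theorem G_V (hx : x ∈ C.O i) : C.G i x (C.V i x) = 0 := by
  rw [V_eq, map_neg, C.G_J i x hx, C.G_U i x hx, map_zero, neg_zero, neg_zero]

theorem H_U (hx : x ∈ C.O i) : C.H i x (C.U i x) = 0 := by
  rw [H_apply, C.G_J i x hx, C.G_U i x hx, map_zero, neg_zero]

theorem H_V (hx : x ∈ C.O i) : C.H i x (C.V i x) = 0 := by
  rw [H_apply, C.G_J i x hx, C.G_V hx, map_zero, neg_zero]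

theorem H_skew (hx : x ∈ C.O i) (X Y) :
    C.g.val x (C.H i x X) Y = -C.g.val x X (C.H i x Y) := by
  rw [H_apply, H_apply, C.G_skew i x hx, g_J, neg_neg, C.G_J i x hx, map_neg, neg_neg]

theorem u_G (hx : x ∈ C.O i) (X) : C.u i x (C.G i x X) = 0 := by
  rw [← C.g_U i x hx, C.g.symm, C.G_skew i x hx, C.G_U i x hx, map_zero, neg_zero]

theorem v_G (hx : x ∈ C.O i) (X) : C.v i x (C.G i x X) = 0 := by
  rw [← C.g_V hx, C.g.symm, C.G_skew i x hx, C.G_V hx, map_zero, neg_zero]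

theorem H_G (hx : x ∈ C.O i) (X) : C.H i x (C.G i x X) = -C.G i x (C.H i x X) := by
  rw [H_apply, H_apply, C.G_J i x hx X, map_neg, neg_neg]

theorem smoothFieldAt_J {X : Π x : N, TangentSpace 𝓘(ℝ, E) x} (hX : SmoothFieldAt X x) :
    SmoothFieldAt (fun y ↦ complexJ y (X y)) x :=
  ContMDiffAt.clm_bundle_apply (contMDiffAt_complexJ x) hX

theorem smoothFieldAt_U (hx : x ∈ C.O i) : SmoothFieldAt (C.U i) x :=
  (C.smooth_U i).contMDiffAt ((C.isOpen_O i).mem_nhds hx)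

theorem smoothFieldAt_V (hx : x ∈ C.O i) : SmoothFieldAt (C.V i) x :=
  ContMDiffAt.neg_section (smoothFieldAt_J (C.smoothFieldAt_U hx))

theorem contMDiffAt_u_apply (hx : x ∈ C.O i) {X : Π x : N, TangentSpace 𝓘(ℝ, E) x}
    (hX : SmoothFieldAt X x) : ContMDiffAt 𝓘(ℝ, E) 𝓘(ℝ, ℝ) ∞ (fun y ↦ C.u i y (X y)) x :=
  contMDiffAt_covector_apply ((C.smooth_u i).contMDiffAt ((C.isOpen_O i).mem_nhds hx)) hX

theorem mdifferentiableEndAt_G (hx : x ∈ C.O i) : MDifferentiableEndAt (C.G i) x :=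
  ((C.smooth_G i).contMDiffAt ((C.isOpen_O i).mem_nhds hx)).mdifferentiableAt (by simp)

theorem mdifferentiableEndAt_H (hx : x ∈ C.O i) : MDifferentiableEndAt (C.H i) x :=
  (C.mdifferentiableEndAt_G hx).comp (mdifferentiableEndAt_complexJ x)

/-- A horizontal vector extends to a horizontal vector field: subtract from any extension its
components along `U` and `V`. -/
theorem exists_horizontal_field (hx : x ∈ C.O i) {w : TangentSpace 𝓘(ℝ, E) x}
    (hu : C.u i x w = 0) (hv : C.v i x w = 0) :
    ∃ X, IsSmoothKernelFieldNear (C.u i) (C.v i) X x ∧ X x = w := by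
  let X₀ : Π y : N, TangentSpace 𝓘(ℝ, E) y := FiberBundle.extend E w
  have hX₀ : ∀ᶠ y in 𝓝 x, SmoothFieldAt X₀ y := by
    obtain ⟨s, hs, hsm⟩ := FiberBundle.exists_contMDiffOn_extend (k := ∞) 𝓘(ℝ, E) E w
    filter_upwards [eventually_mem_nhds_iff.2 hs] with y hy using hsm.contMDiffAt hy
  let X : Π y : N, TangentSpace 𝓘(ℝ, E) y :=
    X₀ - (fun y ↦ C.u i y (X₀ y)) • C.U i - (fun y ↦ C.v i y (X₀ y)) • C.V i
  have hX : ∀ y, X y = X₀ y - C.u i y (X₀ y) • C.U i y - C.v i y (X₀ y) • C.V i y := fun _ ↦ rfl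
  refine ⟨X, ?_, ?_⟩
  · filter_upwards [(C.isOpen_O i).mem_nhds hx, hX₀] with y hy hXy
    refine ⟨?_, ?_, ?_⟩
    · exact (hXy.sub_section ((C.contMDiffAt_u_apply hy hXy).smul_section
        (C.smoothFieldAt_U hy))).sub_section
        ((C.contMDiffAt_u_apply hy (smoothFieldAt_J hXy)).smul_section (C.smoothFieldAt_V hy))
    · simp [hX, C.u_U i y hy, C.u_V hy]
    · simp [hX, C.v_U hy, C.v_V hy]
  · have h₀ : X₀ x = w := FiberBundle.extend_apply_self E w
    rw [hX, h₀, hu, hv]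
    simp

variable {C}

theorem horizontalNear_of_kernel {X : Π x : N, TangentSpace 𝓘(ℝ, E) x}
    (hX : IsSmoothKernelFieldNear (C.u i) (C.v i) X x) : C.HorizontalNear i X x :=
  hX.mono fun _ h ↦ h.2

theorem IsNormal.isNormalContactPair_G (hC : C.IsNormal) (i : ι) :
    IsNormalContactPair C.g (C.O i) (C.u i) (C.v i) (C.σ i) (C.G i) (C.H i) where
  isOpen := C.isOpen_O i
  mdifferentiable x hx := C.mdifferentiableEndAt_G hx
  skew := C.G_skew i
  skew_right x hx := C.H_skew hx
  map_ker x hx X := ⟨C.u_G hx X, C.v_G hx X⟩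
  sq x hx X hu hv := by
    rw [C.G_sq i x hx, hu, ← v_apply, hv]
    simp
  d_left x hx X Y hX hY := C.du_eq i x hx X Y hX hY
  d_right x hx X Y hX hY := C.dv_eq i x hx X Y hX hY
  exists_field x hx w hu hv := C.exists_horizontal_field hx hu hv
  nijenhuis_eq x hx X Y hX hY Z hu hv := by
    have h := (hC.horizontal i x hx X Y hX.self_of_nhds.1 hY.self_of_nhds.1
      (horizontalNear_of_kernel hX) (horizontalNear_of_kernel hY)).1
    have h2 := congrArg (fun W ↦ C.g.val x W Z) h
    simp only [tensorS, hX.self_of_nhds.2.2, hY.self_of_nhds.2.2, map_add, map_sub, map_smul,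
      map_zero, add_apply, sub_apply, smul_apply, zero_apply, smul_eq_mul, C.g_U i x hx, C.g_V hx,
      hu, hv, zero_smul] at h2 ⊢
    linear_combination h2

/-- Exchanging `u` with `v` and `G` with `H` changes the sign of `σ`, and the tensor `S` turns into
`T`. -/
theorem IsNormal.isNormalContactPair_H (hC : C.IsNormal) (i : ι) :
    IsNormalContactPair C.g (C.O i) (C.v i) (C.u i) (-C.σ i) (C.H i) (C.G i) where
  isOpen := C.isOpen_O i
  mdifferentiable x hx := C.mdifferentiableEndAt_H hx
  skew x hx := C.H_skew hx
  skew_right := C.G_skew i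
  map_ker x hx X := ⟨C.v_G hx _, C.u_G hx _⟩
  sq x hx X hv hu := by
    rw [H_apply, H_apply, C.H_sq i x hx, hu, ← v_apply, hv]
    simp
  d_left x hx X Y hX hY := by
    have h := C.dv_eq i x hx X Y hX hY
    refine h.trans ?_
    simp only [covectorWedge, Pi.neg_apply, neg_apply, H_apply]
    ring
  d_right x hx X Y hX hY := by
    have h := C.du_eq i x hx X Y hX hY
    refine h.trans ?_
    simp only [covectorWedge, Pi.neg_apply, neg_apply, v_apply]
    ring
  exists_field x hx w hv hu := by
    obtain ⟨X, hX, hXw⟩ := C.exists_horizontal_field hx hu hv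
    exact ⟨X, hX.mono fun _ h ↦ ⟨h.1, h.2.symm⟩, hXw⟩
  nijenhuis_eq x hx X Y hX hY Z hv hu := by
    have hX' : IsSmoothKernelFieldNear (C.u i) (C.v i) X x := hX.mono fun _ h ↦ ⟨h.1, h.2.symm⟩
    have hY' : IsSmoothKernelFieldNear (C.u i) (C.v i) Y x := hY.mono fun _ h ↦ ⟨h.1, h.2.symm⟩
    have h := (hC.horizontal i x hx X Y hX.self_of_nhds.1 hY.self_of_nhds.1
      (horizontalNear_of_kernel hX') (horizontalNear_of_kernel hY')).2
    have h2 := congrArg (fun W ↦ C.g.val x W Z) h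
    simp only [tensorT, hX.self_of_nhds.2.2, hY.self_of_nhds.2.2, map_add, map_sub, map_smul,
      map_zero, add_apply, sub_apply, smul_apply, zero_apply, smul_eq_mul, C.g_U i x hx, C.g_V hx,
      hu, hv, zero_smul, Pi.neg_apply, neg_apply, C.H_G hx, smul_neg, neg_smul, map_neg] at h2 ⊢
    linear_combination h2

end ComplexContactMetricStructure

end

/-! ### Covariant derivatives of the structure tensors and screen real submanifolds -/

section

theorem covEnd_comp {E : Type*} [NormedAddCommGroup E] [NormedSpace ℝ E] [FiniteDimensional ℝ E]
    {N : Type*} [TopologicalSpace N] [ChartedSpace E N] [IsManifold 𝓘(ℝ, E) ∞ N]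
    (cov : CovariantDerivative 𝓘(ℝ, E) E (TangentSpace 𝓘(ℝ, E) : N → Type _))
    {A B : Π x : N, TangentSpace 𝓘(ℝ, E) x →L[ℝ] TangentSpace 𝓘(ℝ, E) x} {x : N}
    (hA : MDifferentiableEndAt A x) (hB : MDifferentiableEndAt B x)
    (w y : TangentSpace 𝓘(ℝ, E) x) :
    covEnd cov (fun y ↦ (A y).comp (B y)) x w y
      = covEnd cov A x w (B x y) + A x (covEnd cov B x w y) := by
  have h := cov_endo_apply cov hA
    (MDifferentiableAt.clm_bundle_apply hB (FiberBundle.mdifferentiableAt_extend 𝓘(ℝ, E) E y)) w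
  rw [FiberBundle.extend_apply_self] at h
  have h2 : covEnd cov (fun y ↦ (A y).comp (B y)) x w y
      = cov (fun z ↦ A z (B z (FiberBundle.extend E y z))) x w
        - A x (B x (cov (FiberBundle.extend E y) x w)) := rfl
  rw [h2, h, covEnd, covEnd, map_sub]
  abel

namespace ComplexContactMetricStructure

variable {E : Type*} [NormedAddCommGroup E] [NormedSpace ℂ E]
  {N : Type*} [TopologicalSpace N] [ChartedSpace E N] [IsManifold 𝓘(ℂ, E) ω N]
  {ι : Type*} {n : ℕ} {C : ComplexContactMetricStructure ι n E N} {i : ι} {x : N}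

/-- A vector orthogonal to all horizontal vectors is a combination of `U` and `V`. -/
theorem eq_vertical_of_forall_horizontal (hx : x ∈ C.O i) {W : TangentSpace 𝓘(ℝ, E) x}
    (hW : ∀ Z, C.u i x Z = 0 → C.v i x Z = 0 → C.g.val x W Z = 0) :
    W = C.u i x W • C.U i x + C.v i x W • C.V i x := by
  rw [← sub_eq_zero]
  set W' := W - (C.u i x W • C.U i x + C.v i x W • C.V i x) with hW'
  have hu : C.u i x W' = 0 := by simp [hW', C.u_U i x hx, C.u_V hx]
  have hv : C.v i x W' = 0 := by simp [hW', C.v_U hx, C.v_V hx]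
  apply C.g.nondegenerate x
  intro Z
  set Z' := Z - (C.u i x Z • C.U i x + C.v i x Z • C.V i x) with hZ'
  have hu' : C.u i x Z' = 0 := by simp [hZ', C.u_U i x hx, C.u_V hx]
  have hv' : C.v i x Z' = 0 := by simp [hZ', C.v_U hx, C.v_V hx]
  have h1 : C.g.val x W' (C.U i x) = 0 := by rw [C.g.symm, C.g_U i x hx, hu]
  have h2 : C.g.val x W' (C.V i x) = 0 := by rw [C.g.symm, C.g_V hx, hv]
  have h4 : Z = Z' + (C.u i x Z • C.U i x + C.v i x Z • C.V i x) := by simp [hZ']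
  clear_value Z'
  have h3 : C.g.val x W' Z' = 0 := by
    rw [hW', map_sub, sub_apply, hW Z' hu' hv', map_add, add_apply, map_smul, map_smul, smul_apply,
      smul_apply, C.g_U i x hx, C.g_V hx, hu', hv']
    simp
  rw [h4, map_add, map_add, map_smul, map_smul, h1, h2, h3]
  simp

variable (C)

theorem mdifferentiableEndAt_Ja (hx : x ∈ C.O i) (a : Fin 3) :
    MDifferentiableEndAt (C.Ja a i) x :=
  match a with
  | 0 => mdifferentiableEndAt_complexJ x
  | 1 => C.mdifferentiableEndAt_G hx
  | 2 => C.mdifferentiableEndAt_H hx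

theorem Ja_Ja (hx : x ∈ C.O i) (a : Fin 3) {X : TangentSpace 𝓘(ℝ, E) x} (hu : C.u i x X = 0)
    (hv : C.v i x X = 0) : C.Ja a i x (C.Ja a i x X) = -X := by
  match a with
  | 0 => exact complexJ_complexJ x X
  | 1 =>
    refine (C.G_sq i x hx X).trans ?_
    rw [hu, ← v_apply, hv]
    simp
  | 2 =>
    refine (C.H_sq i x hx X).trans ?_
    rw [hu, ← v_apply, hv]
    simp

theorem Ja_vertical (hx : x ∈ C.O i) (a : Fin 3) (c d : ℝ) :
    ∃ c' d' : ℝ, C.Ja a i x (c • C.U i x + d • C.V i x) = c' • C.U i x + d' • C.V i x := by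
  match a with
  | 0 =>
    refine ⟨d, -c, ?_⟩
    have h : complexJ x (C.V i x) = C.U i x := by
      rw [V_eq, map_neg, complexJ_complexJ, neg_neg]
    have h' : complexJ x (C.U i x) = -C.V i x := by rw [V_eq, neg_neg]
    change complexJ x _ = _
    rw [map_add, map_smul, map_smul, h, h', smul_neg, neg_smul, add_comm]
  | 1 =>
    refine ⟨0, 0, ?_⟩
    change C.G i x _ = _
    rw [map_add, map_smul, map_smul, C.G_U i x hx, C.G_V hx]
    simp
  | 2 =>
    refine ⟨0, 0, ?_⟩
    change C.H i x _ = _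
    rw [map_add, map_smul, map_smul, C.H_U hx, C.H_V hx]
    simp

variable {C}

variable {F : Type*} [NormedAddCommGroup F] [NormedSpace ℝ F]
  {M : Type*} [TopologicalSpace M] [ChartedSpace F M] [IsManifold 𝓘(ℝ, F) ∞ M]
  {S : NullSubmanifold C.g F M}

/-- A screen real null submanifold is horizontal, because `U` and `V` are normal to it. -/
theorem IsScreenReal.horizontal_push (hS : C.IsScreenReal S) {p : M} (hp : S.f p ∈ C.O i)
    (w : TangentSpace 𝓘(ℝ, F) p) :
    C.u i (S.f p) (S.push p w) = 0 ∧ C.v i (S.f p) (S.push p w) = 0 := by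
  have hle : S.screenT p ≤ normalAt C.g (F := F) S.f p := by
    rw [← S.screenT_sup p]
    exact le_sup_right
  rw [← C.g_U i _ hp, ← C.g_V hp]
  exact ⟨hle (hS.U_mem i p hp) w, hle (hS.V_mem i p hp) w⟩

theorem mdifferentiableAt_push (S : NullSubmanifold C.g F M) {ξ : Π p : M, TangentSpace 𝓘(ℝ, F) p}
    (hξ : ContMDiff 𝓘(ℝ, F) 𝓘(ℝ, F).tangent ∞
      (fun p ↦ (TotalSpace.mk' F p (ξ p) : TangentBundle 𝓘(ℝ, F) M))) (p : M) :
    MDifferentiableAt 𝓘(ℝ, F) 𝓘(ℝ, E).tangent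
      (fun p ↦ (TotalSpace.mk' E (S.f p) (S.push p (ξ p)) : TangentBundle 𝓘(ℝ, E) N)) p := by
  have h := (S.smooth_f.contMDiff_tangentMap (m := 1) (by exact WithTop.coe_le_coe.2 le_top)).comp
    (hξ.of_le (m := 1) (by exact WithTop.coe_le_coe.2 le_top))
  exact h.contMDiffAt.mdifferentiableAt (by simp)

variable [FiniteDimensional ℂ E] [FiniteDimensional ℝ F]
  {cov : CovariantDerivative 𝓘(ℝ, E) E (TangentSpace 𝓘(ℝ, E) : N → Type _)}

/-- `(∇_X G) Y = σ(X) H Y` for horizontal `X`, `Y`, up to a combination of `U` and `V`. -/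
theorem IsNormal.covEnd_G (hC : C.IsNormal) (hcov : C.g.IsLeviCivita cov) (hx : x ∈ C.O i)
    {X Y : TangentSpace 𝓘(ℝ, E) x} (hX : C.u i x X = 0 ∧ C.v i x X = 0)
    (hY : C.u i x Y = 0 ∧ C.v i x Y = 0) :
    ∃ c d : ℝ, covEnd cov (C.G i) x X Y
      = C.σ i x X • C.H i x Y + (c • C.U i x + d • C.V i x) := by
  have : FiniteDimensional ℝ E := FiniteDimensional.complexToReal E
  refine ⟨_, _, sub_eq_iff_eq_add'.1 (eq_vertical_of_forall_horizontal hx ?_)⟩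
  intro Z hu hv
  rw [map_sub, sub_apply, (hC.isNormalContactPair_G i).metric_covEnd hcov hx hX hY ⟨hu, hv⟩,
    map_smul, smul_apply, smul_eq_mul, sub_self]

/-- `(∇_X H) Y = -σ(X) G Y` for horizontal `X`, `Y`, up to a combination of `U` and `V`. -/
theorem IsNormal.covEnd_H (hC : C.IsNormal) (hcov : C.g.IsLeviCivita cov) (hx : x ∈ C.O i)
    {X Y : TangentSpace 𝓘(ℝ, E) x} (hX : C.u i x X = 0 ∧ C.v i x X = 0)
    (hY : C.u i x Y = 0 ∧ C.v i x Y = 0) :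
    ∃ c d : ℝ, covEnd cov (C.H i) x X Y
      = -C.σ i x X • C.G i x Y + (c • C.U i x + d • C.V i x) := by
  have : FiniteDimensional ℝ E := FiniteDimensional.complexToReal E
  refine ⟨_, _, sub_eq_iff_eq_add'.1 (eq_vertical_of_forall_horizontal hx ?_)⟩
  intro Z hu hv
  rw [map_sub, sub_apply, (hC.isNormalContactPair_H i).metric_covEnd hcov hx hX.symm hY.symm
    ⟨hv, hu⟩, map_smul, smul_apply, smul_eq_mul]
  exact sub_self _

/-- `(∇_X J) Y` is a combination of `U` and `V` for horizontal `X`, `Y`. This follows from the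
formulas for `∇G` and `∇H`, because `H = G J`. -/
theorem IsNormal.covEnd_J (hC : C.IsNormal) (hcov : C.g.IsLeviCivita cov) (hx : x ∈ C.O i)
    {X Y : TangentSpace 𝓘(ℝ, E) x} (hX : C.u i x X = 0 ∧ C.v i x X = 0)
    (hY : C.u i x Y = 0 ∧ C.v i x Y = 0) :
    ∃ c d : ℝ, covEnd cov complexJ x X Y = c • C.U i x + d • C.V i x := by
  have : FiniteDimensional ℝ E := FiniteDimensional.complexToReal E
  have hJY : C.u i x (complexJ x Y) = 0 ∧ C.v i x (complexJ x Y) = 0 :=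
    ⟨hY.2, by rw [v_J, hY.1, neg_zero]⟩
  obtain ⟨c₁, d₁, h₁⟩ := hC.covEnd_G hcov hx hX hJY
  obtain ⟨c₂, d₂, h₂⟩ := hC.covEnd_H hcov hx hX hY
  have h := covEnd_comp cov (C.mdifferentiableEndAt_G hx) (mdifferentiableEndAt_complexJ x) X Y
  have hH : covEnd cov (fun y ↦ (C.G i y).comp (complexJ y)) x X Y = covEnd cov (C.H i) x X Y := rfl
  set D := covEnd cov complexJ x X Y with hD
  rw [hH, h₁, h₂, H_apply, complexJ_complexJ, map_neg, smul_neg, ← neg_smul, add_assoc,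
    add_right_inj] at h
  -- `G D` is vertical, and `G` annihilates vertical vectors, so `D` is vertical
  have h3 := congrArg (C.G i x) h
  simp only [map_add, map_smul, C.G_U i x hx, C.G_V hx, C.G_sq i x hx] at h3
  refine ⟨C.u i x D, C.v i x D, ?_⟩
  have h4 : C.u i x D • C.U i x + C.v i x D • C.V i x - D = 0 := by
    refine Eq.trans ?_ (h3.symm.trans ?_)
    · rw [v_apply, V_eq]
      simp only [smul_zero, add_zero, zero_add]
      abel
    · simp
  exact (sub_eq_zero.1 h4).symm

/-- The common consequence for `J`, `G` and `H` on which the theorem rests: up to a combination of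
`U` and `V`, `(∇_X J_a) Y` is a multiple of some `J_b Y`. -/
theorem IsNormal.covEnd_Ja (hC : C.IsNormal) (hcov : C.g.IsLeviCivita cov) (hx : x ∈ C.O i)
    (a : Fin 3) {X Y : TangentSpace 𝓘(ℝ, E) x} (hX : C.u i x X = 0 ∧ C.v i x X = 0)
    (hY : C.u i x Y = 0 ∧ C.v i x Y = 0) :
    ∃ (b : Fin 3) (s c d : ℝ), covEnd cov (C.Ja a i) x X Y
      = s • C.Ja b i x Y + (c • C.U i x + d • C.V i x) := by
  match a with
  | 0 =>
    obtain ⟨c, d, h⟩ := hC.covEnd_J hcov hx hX hY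
    exact ⟨0, 0, c, d, by rw [zero_smul, zero_add]; exact h⟩
  | 1 =>
    obtain ⟨c, d, h⟩ := hC.covEnd_G hcov hx hX hY
    exact ⟨2, _, c, d, h⟩
  | 2 =>
    obtain ⟨c, d, h⟩ := hC.covEnd_H hcov hx hX hY
    exact ⟨1, _, c, d, h⟩

/-- The difference of the two sides of the criterion is, up to sign, the screen component `z` of
`[ξ₁, ξ₂] = ρ + z`. Along `M` one has
`∇_{ξ₁} J_a ξ₂ - ∇_{ξ₂} J_a ξ₁ = (∇_{ξ₁} J_a) ξ₂ - (∇_{ξ₂} J_a) ξ₁ + J_a ρ + J_a z`. Its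
`S(TM^⊥)`-part is `J_a z` up to a combination of `U` and `V`, since every `J_b` preserves the
radical; applying `B_a` gives `-z`. -/
theorem IsScreenReal.Ba_hs_sub (hC : C.IsNormal) (hcov : C.g.IsLeviCivita cov)
    (hS : C.IsScreenReal S) (a : Fin 3) {ξ₁ ξ₂ : Π p : M, TangentSpace 𝓘(ℝ, F) p}
    (hξ₁ : IsSectionOf S.rad ξ₁) (hξ₂ : IsSectionOf S.rad ξ₂) {p : M} (hp : S.f p ∈ C.O i)
    {ρ z : TangentSpace 𝓘(ℝ, F) p} (hρ : ρ ∈ S.rad p) (hz : z ∈ S.screen p)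
    (hρz : ρ + z = VectorField.mlieBracket 𝓘(ℝ, F) ξ₁ ξ₂ p) :
    C.Ba S a i p (S.hs cov ξ₁ (fun y ↦ C.Ja a i (S.f y) (S.push y (ξ₂ y))) p)
      - C.Ba S a i p (S.hs cov ξ₂ (fun y ↦ C.Ja a i (S.f y) (S.push y (ξ₁ y))) p)
      = -S.push p z := by
  have : FiniteDimensional ℝ E := FiniteDimensional.complexToReal E
  have hs₁ := contMDiffOn_univ.1 hξ₁.1
  have hs₂ := contMDiffOn_univ.1 hξ₂.1
  have hf2 : ContMDiffAt 𝓘(ℝ, F) 𝓘(ℝ, E) 2 S.f p :=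
    S.smooth_f.contMDiffAt.of_le (WithTop.coe_le_coe.2 le_top)
  have hf : MDifferentiableAt 𝓘(ℝ, F) 𝓘(ℝ, E) S.f p := hf2.mdifferentiableAt (by simp)
  have hbr := covAlong_sub_covAlong hcov hf2 (hs₁.contMDiffAt.mdifferentiableAt (by simp))
    (hs₂.contMDiffAt.mdifferentiableAt (by simp))
  have hJ := C.mdifferentiableEndAt_Ja hp a
  have hJa : ∀ b, ∀ w ∈ S.rad p, S.screenTPart p (C.Ja b i (S.f p) (S.push p w)) = 0 := by
    intro b w hw
    have hmem : C.Ja b i (S.f p) (S.push p w) ∈ (S.rad p).map (S.push p).toLinearMap := by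
      rw [← hS.map_rad b i p hp]
      exact Submodule.mem_map_of_mem (Submodule.mem_map_of_mem hw)
    refine Submodule.projection_apply_of_mem_right _ (Submodule.mem_sup_left ?_)
    obtain ⟨w', -, hw'⟩ := hmem
    exact ⟨w', hw'⟩
  have hvert : ∀ c d : ℝ, c • C.U i (S.f p) + d • C.V i (S.f p) ∈ S.screenT p := fun c d ↦
    Submodule.add_mem _ (Submodule.smul_mem _ _ (hS.U_mem i p hp))
      (Submodule.smul_mem _ _ (hS.V_mem i p hp))
  have hfix : ∀ W ∈ S.screenT p, S.screenTPart p W = W := fun W hW ↦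
    Submodule.projection_apply_of_mem_left _ hW
  obtain ⟨b₁, s₁, c₁, d₁, h₁⟩ := hC.covEnd_Ja hcov hp a (hS.horizontal_push hp (ξ₁ p))
    (hS.horizontal_push hp (ξ₂ p))
  obtain ⟨b₂, s₂, c₂, d₂, h₂⟩ := hC.covEnd_Ja hcov hp a (hS.horizontal_push hp (ξ₂ p))
    (hS.horizontal_push hp (ξ₁ p))
  have e₁ := covAlong_endo_apply cov hJ hf (mdifferentiableAt_push S hs₂ p) (ξ₁ p)
  have e₂ := covAlong_endo_apply cov hJ hf (mdifferentiableAt_push S hs₁ p) (ξ₂ p)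
  have hJz : C.Ja a i (S.f p) (S.push p z) ∈ S.screenT p :=
    hS.map_screen a i p hp (Submodule.mem_map_of_mem (Submodule.mem_map_of_mem hz))
  have hsub : S.hs cov ξ₁ (fun y ↦ C.Ja a i (S.f y) (S.push y (ξ₂ y))) p
      - S.hs cov ξ₂ (fun y ↦ C.Ja a i (S.f y) (S.push y (ξ₁ y))) p
      = C.Ja a i (S.f p) (S.push p z)
        + ((c₁ - c₂) • C.U i (S.f p) + (d₁ - d₂) • C.V i (S.f p)) := by
    have h3 : covAlong cov S.f (fun y ↦ C.Ja a i (S.f y) (S.push y (ξ₂ y))) p (ξ₁ p)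
        - covAlong cov S.f (fun y ↦ C.Ja a i (S.f y) (S.push y (ξ₁ y))) p (ξ₂ p)
        = s₁ • C.Ja b₁ i (S.f p) (S.push p (ξ₂ p)) - s₂ • C.Ja b₂ i (S.f p) (S.push p (ξ₁ p))
          + C.Ja a i (S.f p) (S.push p ρ) + C.Ja a i (S.f p) (S.push p z)
          + ((c₁ - c₂) • C.U i (S.f p) + (d₁ - d₂) • C.V i (S.f p)) := by
      have h4 : S.push p ρ + S.push p z = covAlong cov S.f (fun q ↦ S.push q (ξ₂ q)) p (ξ₁ p)
          - covAlong cov S.f (fun q ↦ S.push q (ξ₁ q)) p (ξ₂ p) := by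
        rw [← map_add, hρz]
        exact hbr.symm
      have h5 := congrArg (C.Ja a i (S.f p)) h4
      rw [map_add, map_sub] at h5
      rw [e₁, e₂, add_assoc (_ - _), h5]
      change covEnd cov (C.Ja a i) (S.f p) (S.push p (ξ₁ p)) (S.push p (ξ₂ p)) + _
        - (covEnd cov (C.Ja a i) (S.f p) (S.push p (ξ₂ p)) (S.push p (ξ₁ p)) + _) = _
      rw [h₁, h₂]
      module
    rw [NullSubmanifold.hs, NullSubmanifold.hs, ← map_sub, h3, map_add, map_add, map_add, map_sub,
      map_smul, map_smul, hJa b₁ _ (hξ₂.2 p), hJa b₂ _ (hξ₁.2 p), hJa a ρ hρ, hfix _ hJz,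
      hfix _ (hvert _ _)]
    simp
  obtain ⟨c, d, hcd⟩ := C.Ja_vertical hp a (c₁ - c₂) (d₁ - d₂)
  obtain ⟨hu, hv⟩ := hS.horizontal_push hp z
  have htan : S.tangentialPart p (S.push p z) = S.push p z :=
    Submodule.projection_apply_of_mem_left _ ⟨z, rfl⟩
  rw [Ba, Ba, ← map_sub, ← map_sub, hsub, map_add, C.Ja_Ja hp a hu hv, hcd, map_add, map_neg, htan]
  have h0 : S.tangentialPart p (c • C.U i (S.f p) + d • C.V i (S.f p)) = 0 :=
    Submodule.projection_apply_of_mem_right _ (Submodule.mem_sup_right (hvert c d))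
  rw [h0, add_zero]

end ComplexContactMetricStructure

end

theorem mainTheorem5
    {E : Type*} [NormedAddCommGroup E] [NormedSpace ℂ E] [FiniteDimensional ℂ E]
    {N : Type*} [TopologicalSpace N] [T2Space N] [SecondCountableTopology N]
    [ChartedSpace E N] [IsManifold 𝓘(ℂ, E) ω N]
    {F : Type*} [NormedAddCommGroup F] [NormedSpace ℝ F] [FiniteDimensional ℝ F]
    {M : Type*} [TopologicalSpace M] [T2Space M] [SecondCountableTopology M]
    [ChartedSpace F M] [IsManifold 𝓘(ℝ, F) ∞ M]
    {ι : Type*} {n q : ℕ} (hq : 0 < q) (hqn : q < n)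
    (C : ComplexContactMetricStructure ι n E N) (hindex : C.g.HasIndex (4 * q))
    (hnormal : C.IsNormal)
    (cov : CovariantDerivative 𝓘(ℝ, E) E (TangentSpace 𝓘(ℝ, E) : N → Type _))
    (hcov : C.g.IsLeviCivita cov)
    (S : NullSubmanifold C.g F M) (hS : C.IsScreenReal S) (a : Fin 3) :
    IsIntegrableDistribution S.rad ↔
      ∀ ξ₁ ξ₂ : Π p : M, TangentSpace 𝓘(ℝ, F) p, IsSectionOf S.rad ξ₁ → IsSectionOf S.rad ξ₂ →
        ∀ i p, S.f p ∈ C.O i →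
          C.Ba S a i p (S.hs cov ξ₁ (fun y ↦ C.Ja a i (S.f y) (S.push y (ξ₂ y))) p)
            = C.Ba S a i p (S.hs cov ξ₂ (fun y ↦ C.Ja a i (S.f y) (S.push y (ξ₁ y))) p) := by
  constructor
  · intro h ξ₁ ξ₂ hξ₁ hξ₂ i p hp
    have := hS.Ba_hs_sub hnormal hcov a hξ₁ hξ₂ hp (h ξ₁ ξ₂ hξ₁ hξ₂ p) (Submodule.zero_mem _)
      (add_zero _)
    rwa [map_zero, neg_zero, sub_eq_zero] at this
  · intro h ξ₁ ξ₂ hξ₁ hξ₂ p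
    obtain ⟨i, hp⟩ := C.cover (S.f p)
    have hmem : VectorField.mlieBracket 𝓘(ℝ, F) ξ₁ ξ₂ p ∈ S.rad p ⊔ S.screen p := by
      rw [show S.rad p ⊔ S.screen p = ⊤ from (S.isCompl_screen p).sup_eq_top]
      exact Submodule.mem_top
    obtain ⟨ρ, hρ, z, hz, hρz⟩ := Submodule.mem_sup.1 hmem
    have h1 := hS.Ba_hs_sub hnormal hcov a hξ₁ hξ₂ hp hρ hz hρz
    rw [h ξ₁ ξ₂ hξ₁ hξ₂ i p hp, sub_self, zero_eq_neg] at h1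
    have hz0 : z = 0 := S.immersion_f p (h1.trans (map_zero (S.push p)).symm)
    rw [← hρz, hz0, add_zero]
    exact hρ
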